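/- Let $\mathcal S=\{1,2,4,5,8,\ldots\}$ be the set of all positive integers that are sums of two squares of integers, and for a real number $y$ let $R(y)=\min_{n\in\mathcal S}|y-n|$ be the distance from $y$ to the nearest element of $\mathcal S$. There is an absolute constant $C>0$ such that for all real $x,H>3$ the set $M(H,x)$ of all real $y$ with $0\le y\le x$ and $R(y)\ge H$ satisfies $$\mu(M(H,x))\le C\,\frac{x(\ln x)^{3/2}}{H},$$ where $\mu$ is the Lebesgue measure. -/

import Mathlib

/-- The set `1, 2, 4, 5, 8, …` of positive integers that are sums of two squares of integers. -/
def sumsOfTwoSquares : Set ℕ :=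
  {n | 0 < n ∧ ∃ a b : ℤ, (n : ℤ) = a ^ 2 + b ^ 2}

/-- `R y` is the distance from the real number `y` to the nearest element of
`sumsOfTwoSquares`, i.e. `min |y - n|` over these `n`. -/
noncomputable def R (y : ℝ) : ℝ :=
  sInf {d : ℝ | ∃ n ∈ sumsOfTwoSquares, d = |y - (n : ℝ)|}

/-- The infimum in the definition of `R` is attained, so it is a minimum. -/
theorem R_isLeast (y : ℝ) :
    IsLeast {d : ℝ | ∃ n ∈ sumsOfTwoSquares, d = |y - (n : ℝ)|} (R y) := by
  have hcl : IsClosed (((↑) : ℕ → ℝ) '' sumsOfTwoSquares) :=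
    Nat.isClosedEmbedding_coe_real.isClosedMap _ (isClosed_discrete _)
  have hne : (((↑) : ℕ → ℝ) '' sumsOfTwoSquares).Nonempty :=
    ⟨1, 1, ⟨one_pos, 1, 0, by simp⟩, by simp⟩
  obtain ⟨_, ⟨n, hn, rfl⟩, hd⟩ := hcl.exists_infDist_eq_dist hne y
  have hl : IsLeast {d : ℝ | ∃ n ∈ sumsOfTwoSquares, d = |y - (n : ℝ)|} (|y - (n : ℝ)|) := by
    refine ⟨⟨n, hn, rfl⟩, ?_⟩
    rintro d ⟨m, hm, rfl⟩
    rw [← Real.dist_eq, ← Real.dist_eq, ← hd]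
    exact Metric.infDist_le_dist_of_mem ⟨m, hm, rfl⟩
  have h : R y = |y - (n : ℝ)| := hl.csInf_eq
  rw [h]
  exact hl

/-! Write e(t) = exp(2πit), α = 1/x and w = α + 2βi. An integer has π representations as a sum of
two squares on average, so E(β) = Σ_{n≥1} π exp(-παn) e(-nβ) - Σ_{v∈ℤ²} exp(-πα|v|²) e(-|v|²β),
which is `thetaError`, should be small in mean square. Let J be a set of starting points of windows
of L consecutive integers without sums of two squares, and let D_J, D_L be the exponential sums over
J and over 0, ..., L-1. Integrating E·D_J·D_L kills the theta series and leaves a positive sum ≫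
L|J|. Cauchy-Schwarz with ∫|D_J|² ≪ |J| gives L²|J| ≪ V, where V = ∫|E·D_L|². The bound V ≪ L x log
x (`integral_thetaError_expSum_le`) then yields |J| L ≪ x log x (`card_gap_mul_le`). This is
stronger than the claim, whose exponent 3/2 only uses log x ≥ 1.

To bound V, apply θ(w) = w⁻¹θ(w⁻¹). The term w⁻¹ cancels the main term up to O(1) and leaves
w⁻¹ψ(w⁻¹), with ψ the theta series without its constant term. Take τ = -Im w⁻¹ as new variable; then
|w|⁻² dβ ≪ |dτ|. On the strip k/2 < τ ≤ (k+1)/2 the real part of w⁻¹ lies in [ρ, 5ρ] with ρ = αk²/4,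
and |D_L|² ≪ min(L², k²). A Sobolev-type majorant removes the dependence on the real part, and
Parseval over a period reduces the mean square of ψ to pairs of vectors of equal length,
contributing ≪ ρ⁻¹ log x (`equalNormSum_le`). The strip gives ≪ x log x · min(L², k²)/k²
(`lintegral_heightStrip_le`), and summing over k gives ≪ L x log x. -/

/-! ### Gaussian sums over nonzero lattice vectors. -/

/-- The squared Euclidean length of an integer vector. -/
def latticeNorm (v : ℤ × ℤ) : ℤ := v.1 ^ 2 + v.2 ^ 2

/-- The nonzero vectors of `ℤ²`. -/
abbrev PuncturedLattice : Type := {v : ℤ × ℤ // v ≠ 0}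

theorem one_le_latticeNorm (v : PuncturedLattice) : 1 ≤ latticeNorm v := by
  obtain ⟨⟨a, b⟩, h⟩ := v
  have h' : a ≠ 0 ∨ b ≠ 0 := by
    by_contra hc
    push Not at hc
    exact h (by simp [hc.1, hc.2])
  have : 0 < latticeNorm (a, b) := by
    unfold latticeNorm
    rcases h' with h' | h' <;> positivity
  exact this

theorem one_le_latticeNorm_real (v : PuncturedLattice) : (1 : ℝ) ≤ (latticeNorm v : ℝ) := by
  exact_mod_cast one_le_latticeNorm v

/-- With y = s(n+1), exp(-y²) ≤ 1/(1+y²), and (1+sn)(1+y) ≤ (1+y)² ≤ 2(1+y²). -/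
theorem exp_neg_sq_le_telescope {s : ℝ} (hs : 0 < s) (n : ℕ) :
    Real.exp (-(s ^ 2 * ((n : ℝ) + 1) ^ 2)) ≤
      2 / s * (1 / (1 + s * n) - 1 / (1 + s * ((n + 1 : ℕ) : ℝ))) := by
  have h1 : Real.exp (-(s ^ 2 * ((n : ℝ) + 1) ^ 2)) ≤ 1 / (1 + s ^ 2 * ((n : ℝ) + 1) ^ 2) := by
    rw [Real.exp_neg, ← one_div]
    apply one_div_le_one_div_of_le (by positivity)
    linarith [Real.add_one_le_exp (s ^ 2 * ((n : ℝ) + 1) ^ 2)]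
  refine h1.trans ?_
  have h2 : 2 / s * (1 / (1 + s * n) - 1 / (1 + s * ((n + 1 : ℕ) : ℝ))) =
      2 / ((1 + s * n) * (1 + s * ((n : ℝ) + 1))) := by
    push_cast
    field_simp
    ring
  rw [h2, div_le_div_iff₀ (by positivity) (by positivity)]
  have hn : (0 : ℝ) ≤ n := n.cast_nonneg
  nlinarith [sq_nonneg (s * ((n : ℝ) + 1) - 1), mul_nonneg hs.le hn, mul_pos hs hs]

theorem sum_exp_neg_sq_le {s : ℝ} (hs : 0 < s) (N : ℕ) :
    ∑ n ∈ Finset.range N, Real.exp (-(s ^ 2 * ((n : ℝ) + 1) ^ 2)) ≤ 2 / s := by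
  refine (Finset.sum_le_sum fun n _ => exp_neg_sq_le_telescope hs n).trans ?_
  rw [← Finset.mul_sum, Finset.sum_range_sub' (fun n : ℕ => 1 / (1 + s * (n : ℝ)))]
  have : 0 ≤ 1 / (1 + s * (N : ℝ)) := by positivity
  have h2 : (0 : ℝ) < 2 / s := by positivity
  simp only [Nat.cast_zero, mul_zero, add_zero, div_one]
  nlinarith

theorem hasSum_int_exp_neg_sq {c : ℝ} (hc : 0 < c) :
    ∃ S : ℝ, HasSum (fun n : ℤ => Real.exp (-(c * (n : ℝ) ^ 2))) S ∧ 0 ≤ S ∧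
      S ≤ 1 + 4 / Real.sqrt c := by
  have hs := Real.sqrt_pos.2 hc
  have hsq := Real.sq_sqrt hc.le
  have hsum : Summable fun n : ℕ => Real.exp (-(c * ((n : ℝ) + 1) ^ 2)) := by
    refine summable_of_sum_range_le (c := 2 / Real.sqrt c) (fun n => (Real.exp_pos _).le) fun N => ?_
    have := sum_exp_neg_sq_le hs N
    rwa [hsq] at this
  have hle : ∑' n : ℕ, Real.exp (-(c * ((n : ℝ) + 1) ^ 2)) ≤ 2 / Real.sqrt c := by
    refine Real.tsum_le_of_sum_range_le (fun n => (Real.exp_pos _).le) fun N => ?_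
    have := sum_exp_neg_sq_le hs N
    rwa [hsq] at this
  have h0 : 0 ≤ ∑' n : ℕ, Real.exp (-(c * ((n : ℝ) + 1) ^ 2)) :=
    tsum_nonneg fun n => (Real.exp_pos _).le
  refine ⟨_, HasSum.of_add_one_of_neg_add_one (f := fun n : ℤ => Real.exp (-(c * (n : ℝ) ^ 2)))
    (m := ∑' n : ℕ, Real.exp (-(c * ((n : ℝ) + 1) ^ 2)))
    (m' := ∑' n : ℕ, Real.exp (-(c * ((n : ℝ) + 1) ^ 2))) ?_ ?_, ?_, ?_⟩
  · simpa using hsum.hasSum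
  · convert hsum.hasSum using 4
    push_cast
    ring
  · simp only [Int.cast_zero]
    positivity
  · simp only [Int.cast_zero]
    norm_num
    rw [show (4 : ℝ) / Real.sqrt c = 2 / Real.sqrt c + 2 / Real.sqrt c by ring]
    linarith

theorem hasSum_lattice_exp {c : ℝ} (hc : 0 < c) :
    ∃ S : ℝ, HasSum (fun v : ℤ × ℤ => Real.exp (-(c * (latticeNorm v : ℝ)))) S ∧
      S ≤ (1 + 4 / Real.sqrt c) ^ 2 := by
  obtain ⟨S, hS, h0, hle⟩ := hasSum_int_exp_neg_sq hc
  refine ⟨S * S, ?_, ?_⟩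
  · have := hS.summable.mul_of_nonneg hS.summable (fun n => (Real.exp_pos _).le)
      (fun n => (Real.exp_pos _).le)
    refine (hS.mul hS this).congr_fun ?_
    intro v
    simp only [latticeNorm, ← Real.exp_add]
    congr 1
    push_cast
    ring
  · rw [sq]
    exact mul_le_mul hle hle h0 (h0.trans hle)

theorem summable_lattice_exp {c : ℝ} (hc : 0 < c) :
    Summable fun v : ℤ × ℤ => Real.exp (-(c * (latticeNorm v : ℝ))) :=
  (hasSum_lattice_exp hc).choose_spec.1.summable

theorem summable_punctured_exp {c : ℝ} (hc : 0 < c) :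
    Summable fun v : PuncturedLattice => Real.exp (-(c * (latticeNorm v : ℝ))) :=
  (summable_lattice_exp hc).comp_injective Subtype.val_injective

theorem tsum_lattice_eq_punctured {E : Type*} [NormedAddCommGroup E] [CompleteSpace E]
    {f : ℤ × ℤ → E} (hf : Summable f) :
    ∑' v, f v = f 0 + ∑' v : PuncturedLattice, f v := by
  have h := hf.tsum_subtype_add_tsum_subtype_compl {(0 : ℤ × ℤ)}
  rw [← h, tsum_singleton]
  rfl

theorem tsum_punctured_exp_le {c : ℝ} (hc : 0 < c) :
    ∑' v : PuncturedLattice, Real.exp (-(c * (latticeNorm v : ℝ))) ≤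
      8 / Real.sqrt c + 16 / c := by
  obtain ⟨S, hS, hle⟩ := hasSum_lattice_exp hc
  have h := tsum_lattice_eq_punctured hS.summable
  rw [hS.tsum_eq] at h
  have h0 : Real.exp (-(c * (latticeNorm 0 : ℝ))) = 1 := by simp [latticeNorm]
  rw [h0] at h
  have hsq := Real.sq_sqrt hc.le
  have : (1 + 4 / Real.sqrt c) ^ 2 = 1 + 8 / Real.sqrt c + 16 / c := by
    rw [add_sq, div_pow, hsq]; ring
  linarith

/-- Since |v|² ≥ 1, half of the exponent can be pulled out as exp(-c/2). A factor exp(c/4) is then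
spent on absorbing c^(-1/2) into 1/c for large c. -/
theorem tsum_punctured_exp_le_exp {c : ℝ} (hc : 0 < c) :
    ∑' v : PuncturedLattice, Real.exp (-(c * (latticeNorm v : ℝ))) ≤
      80 / c * Real.exp (-(c / 4)) := by
  have h1 : ∑' v : PuncturedLattice, Real.exp (-(c * (latticeNorm v : ℝ))) ≤
      Real.exp (-(c / 2)) *
        ∑' v : PuncturedLattice, Real.exp (-(c / 2 * (latticeNorm v : ℝ))) := by
    rw [← tsum_mul_left]
    refine (summable_punctured_exp hc).tsum_le_tsum (fun v => ?_)
      ((summable_punctured_exp (half_pos hc)).mul_left _)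
    rw [← Real.exp_add]
    apply Real.exp_le_exp.2
    nlinarith [one_le_latticeNorm_real v]
  have h2 := tsum_punctured_exp_le (half_pos hc)
  have hs := Real.sqrt_pos.2 (half_pos hc)
  have hsq := Real.sq_sqrt (half_pos hc).le
  set s := Real.sqrt (c / 2)
  have h3 : s ≤ 2 * Real.exp (c / 4) := by
    have := Real.add_one_le_exp (c / 4)
    nlinarith [sq_nonneg (s - 1)]
  have h4 : (1 : ℝ) ≤ Real.exp (c / 4) := Real.one_le_exp (by positivity)
  have h5 : 8 / s + 16 / (c / 2) ≤ 80 / c * Real.exp (c / 4) := by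
    rw [← hsq]
    have hc2 : c = 2 * s ^ 2 := by linarith
    have : 80 / c * Real.exp (c / 4) - (8 / s + 16 / s ^ 2) =
        (8 * (2 * Real.exp (c / 4) - s) + 16 * (Real.exp (c / 4) - 1) +
          8 * Real.exp (c / 4)) / s ^ 2 := by
      rw [show 80 / c = 40 / s ^ 2 by rw [hc2]; field_simp; norm_num]
      field_simp
      ring
    have h6 : 0 ≤ (8 * (2 * Real.exp (c / 4) - s) + 16 * (Real.exp (c / 4) - 1) +
          8 * Real.exp (c / 4)) / s ^ 2 := by
      apply div_nonneg _ (by positivity)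
      nlinarith
    linarith
  calc _ ≤ Real.exp (-(c / 2)) * (80 / c * Real.exp (c / 4)) :=
        h1.trans (mul_le_mul_of_nonneg_left (h2.trans h5) (Real.exp_pos _).le)
    _ = 80 / c * Real.exp (-(c / 4)) := by
        rw [mul_left_comm, ← Real.exp_add]
        ring_nf

theorem tsum_punctured_ofReal_exp_le {c : ℝ} (hc : 0 < c) :
    ∑' v : PuncturedLattice, ENNReal.ofReal (Real.exp (-(c * (latticeNorm v : ℝ)))) ≤
      ENNReal.ofReal (80 / c * Real.exp (-(c / 4))) := by
  rw [← ENNReal.ofReal_tsum_of_nonneg (fun v => (Real.exp_pos _).le) (summable_punctured_exp hc)]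
  exact ENNReal.ofReal_le_ofReal (tsum_punctured_exp_le_exp hc)

theorem lintegral_Ioi_exp_neg_mul {a c : ℝ} (ha : 0 < a) :
    ∫⁻ σ in Set.Ioi c, ENNReal.ofReal (Real.exp (-(σ * a))) =
      ENNReal.ofReal (Real.exp (-(c * a)) / a) := by
  have h := integrableOn_exp_mul_Ioi (neg_lt_zero.2 ha) c
  have h' := integral_exp_mul_Ioi (neg_lt_zero.2 ha) c
  have e : ∀ σ : ℝ, Real.exp (-(σ * a)) = Real.exp (-a * σ) := fun σ => by ring_nf
  simp_rw [e]
  rw [← MeasureTheory.ofReal_integral_eq_lintegral_ofReal h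
    (Filter.Eventually.of_forall fun x => (Real.exp_pos _).le), h']
  simp

/-- The logarithm is ∫ dσ/σ over [c, 1]; beyond 1 the exponential makes the integral bounded. -/
theorem lintegral_Ioi_exp_div_le {c : ℝ} (hc : 0 < c) :
    ∫⁻ σ in Set.Ioi c, ENNReal.ofReal (80 / σ * Real.exp (-(σ / 4))) ≤
      ENNReal.ofReal (1000 * Real.log (2 + 1 / c)) := by
  have hlog2 : (1 / 2 : ℝ) ≤ Real.log (2 + 1 / c) :=
    (by linarith [Real.log_two_gt_d9] : (1 / 2 : ℝ) ≤ Real.log 2).trans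
      (Real.log_le_log (by norm_num) (by linarith [one_div_pos.2 hc]))
  have hbig : ∫⁻ σ in Set.Ioi 1, ENNReal.ofReal (80 / σ * Real.exp (-(σ / 4))) ≤
      ENNReal.ofReal 320 := by
    calc _ ≤ ∫⁻ σ in Set.Ioi (1 : ℝ), ENNReal.ofReal 80 *
            ENNReal.ofReal (Real.exp (-(σ * (1 / 4)))) := by
          refine MeasureTheory.setLIntegral_mono' measurableSet_Ioi fun σ hσ => ?_
          rw [← ENNReal.ofReal_mul (by norm_num)]
          apply ENNReal.ofReal_le_ofReal
          have h1 : 80 / σ ≤ 80 := div_le_self (by norm_num) (le_of_lt hσ)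
          rw [show σ / 4 = σ * (1 / 4) by ring]
          exact mul_le_mul_of_nonneg_right h1 (Real.exp_pos _).le
      _ ≤ ENNReal.ofReal 320 := by
          rw [MeasureTheory.lintegral_const_mul' _ _ ENNReal.ofReal_ne_top,
            lintegral_Ioi_exp_neg_mul (by norm_num), ← ENNReal.ofReal_mul (by norm_num)]
          apply ENNReal.ofReal_le_ofReal
          have : Real.exp (-(1 * (1 / 4))) ≤ 1 := Real.exp_le_one_iff.2 (by norm_num)
          linarith
  rcases le_or_gt 1 c with h | h
  · calc _ ≤ ∫⁻ σ in Set.Ioi 1, ENNReal.ofReal (80 / σ * Real.exp (-(σ / 4))) :=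
          MeasureTheory.lintegral_mono_set (Set.Ioi_subset_Ioi h)
      _ ≤ _ := hbig
      _ ≤ _ := ENNReal.ofReal_le_ofReal (by linarith)
  · have hint : IntervalIntegrable (fun σ : ℝ => 80 * σ⁻¹) MeasureTheory.volume c 1 := by
      apply ContinuousOn.intervalIntegrable
      intro σ hσ
      rw [Set.uIcc_of_le h.le] at hσ
      have : σ ≠ 0 := (hc.trans_le hσ.1).ne'
      fun_prop (disch := assumption)
    have hsmall : ∫⁻ σ in Set.Ioc c 1, ENNReal.ofReal (80 / σ * Real.exp (-(σ / 4))) ≤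
        ENNReal.ofReal (80 * Real.log (1 / c)) := by
      calc _ ≤ ∫⁻ σ in Set.Ioc c 1, ENNReal.ofReal (80 * σ⁻¹) := by
            refine MeasureTheory.setLIntegral_mono' measurableSet_Ioc fun σ hσ => ?_
            apply ENNReal.ofReal_le_ofReal
            have h0 : 0 < σ := hc.trans hσ.1
            have : Real.exp (-(σ / 4)) ≤ 1 := Real.exp_le_one_iff.2 (by linarith)
            rw [← div_eq_mul_inv]
            exact mul_le_of_le_one_right (by positivity) this
        _ = ENNReal.ofReal (∫ σ in c..1, 80 * σ⁻¹) := by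
            rw [intervalIntegral.integral_of_le h.le,
              MeasureTheory.ofReal_integral_eq_lintegral_ofReal]
            · exact (intervalIntegrable_iff_integrableOn_Ioc_of_le h.le).1 hint
            · filter_upwards [MeasureTheory.ae_restrict_mem measurableSet_Ioc] with σ hσ
              have h0 : 0 < σ := hc.trans hσ.1
              simp only [Pi.zero_apply]
              positivity
        _ ≤ _ := by
            rw [intervalIntegral.integral_const_mul, integral_inv_of_pos hc one_pos]
    calc _ ≤ ∫⁻ σ in Set.Ioc c 1 ∪ Set.Ioi 1, ENNReal.ofReal (80 / σ * Real.exp (-(σ / 4))) := by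
          rw [Set.Ioc_union_Ioi_eq_Ioi h.le]
      _ ≤ _ := (MeasureTheory.lintegral_union_le _ _ _)
      _ ≤ ENNReal.ofReal (80 * Real.log (1 / c)) + ENNReal.ofReal 320 := add_le_add hsmall hbig
      _ = ENNReal.ofReal (80 * Real.log (1 / c) + 320) := by
          rw [ENNReal.ofReal_add _ (by norm_num)]
          have : 0 ≤ Real.log (1 / c) := Real.log_nonneg ((one_le_div hc).2 h.le)
          positivity
      _ ≤ _ := by
          apply ENNReal.ofReal_le_ofReal
          have : Real.log (1 / c) ≤ Real.log (2 + 1 / c) :=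
            Real.log_le_log (by positivity) (by linarith)
          linarith

/-- Writing exp(-cN)/N as the integral of exp(-σN) over σ > c reduces this to the undivided sum. -/
theorem tsum_punctured_exp_div_le {c : ℝ} (hc : 0 < c) :
    ∑' v : PuncturedLattice, ENNReal.ofReal
        (Real.exp (-(c * (latticeNorm v : ℝ))) / (latticeNorm v : ℝ)) ≤
      ENNReal.ofReal (1000 * Real.log (2 + 1 / c)) := by
  calc _ = ∑' v : PuncturedLattice, ∫⁻ σ in Set.Ioi c,
          ENNReal.ofReal (Real.exp (-(σ * (latticeNorm v : ℝ)))) := by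
        congr 1 with v
        rw [lintegral_Ioi_exp_neg_mul (by linarith [one_le_latticeNorm_real v])]
    _ = ∫⁻ σ in Set.Ioi c, ∑' v : PuncturedLattice,
          ENNReal.ofReal (Real.exp (-(σ * (latticeNorm v : ℝ)))) := by
        rw [MeasureTheory.lintegral_tsum]
        intro v
        fun_prop
    _ ≤ ∫⁻ σ in Set.Ioi c, ENNReal.ofReal (80 / σ * Real.exp (-(σ / 4))) :=
        MeasureTheory.setLIntegral_mono' measurableSet_Ioi fun σ hσ =>
          tsum_punctured_ofReal_exp_le (hc.trans hσ)
    _ ≤ _ := lintegral_Ioi_exp_div_le hc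

/-! ### Pairs of lattice vectors of equal length. -/

theorem exists_factor_of_mul_eq_mul {u v w z : ℤ} (h : u * v = w * z) :
    ∃ g k s t : ℤ, u = g * s ∧ v = k * t ∧ w = g * t ∧ z = k * s := by
  rcases eq_or_ne u 0 with rfl | hu
  · rw [zero_mul, eq_comm, mul_eq_zero] at h
    rcases h with rfl | rfl
    · exact ⟨0, 1, z, v, by simp⟩
    · exact ⟨w, v, 0, 1, by simp⟩
  · obtain ⟨g, s, ⟨t, rfl⟩, ⟨k, rfl⟩, rfl⟩ := exists_dvd_and_dvd_of_dvd_mul (⟨v, h.symm⟩ : u ∣ w * z)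
    refine ⟨g, k, s, t, rfl, ?_, rfl, mul_comm _ _⟩
    apply mul_left_cancel₀ hu
    rw [h]
    ring

/-- For vectors (a, b) and (c, d) of equal length, (a-c)(a+c) = (d-b)(d+b), and the four factors
split as gs, kt, gt, ks. The parameters are (g, k) and (s, t); if either vanished, so would (a, b).
-/
theorem exists_param_of_latticeNorm_eq (p : PuncturedLattice × PuncturedLattice)
    (hp : latticeNorm p.1 = latticeNorm p.2) :
    ∃ q : PuncturedLattice × PuncturedLattice,
      p.1.1.1 - p.2.1.1 = q.1.1.1 * q.2.1.1 ∧ p.1.1.1 + p.2.1.1 = q.1.1.2 * q.2.1.2 ∧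
      p.2.1.2 - p.1.1.2 = q.1.1.1 * q.2.1.2 ∧ p.2.1.2 + p.1.1.2 = q.1.1.2 * q.2.1.1 := by
  obtain ⟨⟨⟨a, b⟩, h1⟩, ⟨⟨c, d⟩, h2⟩⟩ := p
  simp only [latticeNorm] at hp
  obtain ⟨g, k, s, t, e1, e2, e3, e4⟩ := exists_factor_of_mul_eq_mul
    (show (a - c) * (a + c) = (d - b) * (d + b) by linarith)
  have hne : ¬ (a = 0 ∧ b = 0) := fun h => h1 (by simp [h.1, h.2])
  refine ⟨⟨⟨(g, k), ?_⟩, ⟨(s, t), ?_⟩⟩, e1, e2, e3, e4⟩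
  · intro h
    simp only [Prod.mk_eq_zero] at h
    rw [h.1, zero_mul] at e1 e3
    rw [h.2, zero_mul] at e2 e4
    exact hne ⟨by linarith, by linarith⟩
  · intro h
    simp only [Prod.mk_eq_zero] at h
    rw [h.1, mul_zero] at e1 e4
    rw [h.2, mul_zero] at e2 e3
    exact hne ⟨by linarith, by linarith⟩

/-- The sum of `exp (-c |v|²)` over the pairs of nonzero integer vectors of equal length. -/
noncomputable def equalNormSum (c : ℝ) : ENNReal :=
  ∑' p : {p : PuncturedLattice × PuncturedLattice // latticeNorm p.1 = latticeNorm p.2},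
    ENNReal.ofReal (Real.exp (-(c * (latticeNorm p.1.1 : ℝ))))

/-- The four products determine the pair, so the parametrization is injective. Adding their squares
gives 4|v|² = |q₁|²|q₂|², whence the c/4. -/
theorem equalNormSum_le_product (c : ℝ) :
    equalNormSum c ≤ ∑' q : PuncturedLattice × PuncturedLattice,
      ENNReal.ofReal (Real.exp (-(c / 4 * (latticeNorm q.1 : ℝ) * (latticeNorm q.2 : ℝ)))) := by
  choose F h1 h2 h3 h4 using exists_param_of_latticeNorm_eq
  let G : {p : PuncturedLattice × PuncturedLattice // latticeNorm p.1 = latticeNorm p.2} →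
    PuncturedLattice × PuncturedLattice := fun p => F p.1 p.2
  have hG : Function.Injective G := by
    intro p p' h
    have h : F p.1 p.2 = F p'.1 p'.2 := h
    have e1 := h1 p.1 p.2
    have e2 := h2 p.1 p.2
    have e3 := h3 p.1 p.2
    have e4 := h4 p.1 p.2
    rw [h] at e1 e2 e3 e4
    rw [← h1] at e1
    rw [← h2] at e2
    rw [← h3] at e3
    rw [← h4] at e4
    apply Subtype.ext
    apply Prod.ext <;> apply Subtype.ext <;> apply Prod.ext <;> linarith
  refine le_trans (le_of_eq ?_) (ENNReal.tsum_comp_le_tsum_of_injective hG _)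
  unfold equalNormSum
  congr 1 with p
  have key : 4 * latticeNorm p.1.1 = latticeNorm (G p).1 * latticeNorm (G p).2 := by
    have e1 := h1 p.1 p.2
    have e2 := h2 p.1 p.2
    have e3 := h3 p.1 p.2
    have e4 := h4 p.1 p.2
    have hp := p.2
    simp only [latticeNorm] at hp ⊢
    have : ((G p).1.1.1 ^ 2 + (G p).1.1.2 ^ 2) * ((G p).2.1.1 ^ 2 + (G p).2.1.2 ^ 2) =
      ((G p).1.1.1 * (G p).2.1.1) ^ 2 + ((G p).1.1.2 * (G p).2.1.2) ^ 2 +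
      ((G p).1.1.1 * (G p).2.1.2) ^ 2 + ((G p).1.1.2 * (G p).2.1.1) ^ 2 := by ring
    rw [this]
    simp only [G]
    rw [← e1, ← e2, ← e3, ← e4]
    linear_combination 2 * hp
  have keyR : 4 * (latticeNorm p.1.1 : ℝ) = (latticeNorm (G p).1 : ℝ) * latticeNorm (G p).2 := by
    exact_mod_cast key
  congr 3
  linear_combination c / 4 * keyR

/-- Summing over q₂ at fixed q₁ costs 320/(c|q₁|²) and keeps a decay exp(-c|q₁|²/16); the remaining
sum over q₁ is logarithmic. -/
theorem equalNormSum_le {c : ℝ} (hc : 0 < c) :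
    equalNormSum c ≤ ENNReal.ofReal (320000 / c * Real.log (2 + 16 / c)) := by
  refine (equalNormSum_le_product c).trans ?_
  rw [ENNReal.tsum_prod']
  calc _ ≤ ∑' v : PuncturedLattice, ENNReal.ofReal (320 / c) * ENNReal.ofReal
          (Real.exp (-(c / 16 * (latticeNorm v : ℝ))) / (latticeNorm v : ℝ)) := by
        refine ENNReal.tsum_le_tsum fun v => ?_
        have hv := one_le_latticeNorm_real v
        refine (tsum_punctured_ofReal_exp_le (c := c / 4 * (latticeNorm v : ℝ))
          (by positivity)).trans (le_of_eq ?_)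
        rw [← ENNReal.ofReal_mul (by positivity)]
        congr 1
        rw [show c / 4 * (latticeNorm v : ℝ) / 4 = c / 16 * (latticeNorm v : ℝ) by ring]
        field_simp
        norm_num
    _ ≤ ENNReal.ofReal (320 / c) * ENNReal.ofReal (1000 * Real.log (2 + 1 / (c / 16))) := by
        rw [ENNReal.tsum_mul_left]
        gcongr
        exact tsum_punctured_exp_div_le (by positivity)
    _ = _ := by
        rw [← ENNReal.ofReal_mul (by positivity)]
        congr 1
        rw [show 1 / (c / 16) = 16 / c by field_simp]
        ring

/-! ### Fourier coefficients and Parseval for series of exponentials. -/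

theorem integral_exp_two_pi_int_div {T : ℝ} (hT : T ≠ 0) (a : ℝ) (m : ℤ) :
    ∫ τ in a..a + T, Complex.exp (2 * Real.pi * m / T * Complex.I * τ) =
      if m = 0 then (T : ℂ) else 0 := by
  have hTC : (T : ℂ) ≠ 0 := by exact_mod_cast hT
  split_ifs with hm
  · simp [hm]
  · have hmC : (m : ℂ) ≠ 0 := by exact_mod_cast hm
    have hpi : (Real.pi : ℂ) ≠ 0 := by exact_mod_cast Real.pi_ne_zero
    have hc : (2 * Real.pi * m / T * Complex.I : ℂ) ≠ 0 := by
      simp [hpi, hmC, hTC, Complex.I_ne_zero]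
    rw [integral_exp_mul_complex hc]
    have : (2 * Real.pi * m / T * Complex.I : ℂ) * ((a + T : ℝ) : ℂ) =
        2 * Real.pi * m / T * Complex.I * a + m * (2 * Real.pi * Complex.I) := by
      push_cast
      field_simp
    rw [this, Complex.exp_add, Complex.exp_int_mul_two_pi_mul_I, mul_one, sub_self, zero_div]

theorem norm_ofReal_mul_exp_I (r s : ℝ) :
    ‖(r : ℂ) * Complex.exp (s * Complex.I)‖ = |r| := by
  rw [norm_mul, Complex.norm_exp_ofReal_mul_I, mul_one, Complex.norm_real, Real.norm_eq_abs]

/-- Fourier coefficients of an absolutely convergent series of exponentials. -/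
theorem integral_tsum_exp_mul_exp {ι : Type*} [Countable ι] {a : ι → ℝ}
    (ha : ∀ i, 0 ≤ a i) (hs : Summable a)
    (f : ι → ℤ) (n : ℤ) :
    ∫ β in (-(1 / 2 : ℝ))..(1 / 2), (∑' i, (a i : ℂ) * Complex.exp ((-(2 * Real.pi * f i * β) : ℝ) *
        Complex.I)) * Complex.exp ((2 * Real.pi * n * β : ℝ) * Complex.I) =
      ((∑' i, if f i = n then a i else 0 : ℝ) : ℂ) := by
  have e : ∀ β : ℝ, (∑' i, (a i : ℂ) * Complex.exp ((-(2 * Real.pi * f i * β) : ℝ) *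
        Complex.I)) * Complex.exp ((2 * Real.pi * n * β : ℝ) * Complex.I) =
      ∑' i, (a i : ℂ) * Complex.exp ((2 * Real.pi * (n - f i) * β : ℝ) * Complex.I) := by
    intro β
    rw [← tsum_mul_right]
    congr 1 with i
    rw [mul_assoc, ← Complex.exp_add]
    congr 2
    push_cast
    ring
  simp_rw [e]
  rw [intervalIntegral.integral_of_le (by norm_num),
    ← MeasureTheory.integral_tsum_of_summable_integral_norm]
  · rw [Complex.ofReal_tsum]
    congr 1 with i
    rw [← intervalIntegral.integral_of_le (by norm_num), intervalIntegral.integral_const_mul]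
    have h := integral_exp_two_pi_int_div one_ne_zero (-(1 / 2)) (n - f i)
    rw [show (-(1 / 2 : ℝ)) + 1 = 1 / 2 by norm_num] at h
    have h' : ∫ β in (-(1 / 2 : ℝ))..(1 / 2),
        Complex.exp ((2 * Real.pi * (n - f i) * β : ℝ) * Complex.I) =
        if n - f i = 0 then ((1 : ℝ) : ℂ) else 0 := by
      rw [← h]
      congr 1 with β
      congr 1
      push_cast
      ring
    rw [h']
    by_cases hi : f i = n
    · simp [hi]
    · simp [hi, sub_eq_zero, Ne.symm hi]
  · intro i
    apply Continuous.integrableOn_Ioc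
    fun_prop
  · simp_rw [norm_ofReal_mul_exp_I]
    simpa [abs_of_nonneg (ha _)] using hs.mul_left _

theorem continuous_tsum_exp {ι : Type*} {a : ι → ℝ} (ha : ∀ i, 0 ≤ a i) (hs : Summable a) (f : ι → ℤ) (c : ℝ) :
    Continuous fun β : ℝ =>
      ∑' i, (a i : ℂ) * Complex.exp ((-(c * f i * β) : ℝ) * Complex.I) := by
  refine continuous_tsum (fun i => by fun_prop) hs fun i β => ?_
  rw [norm_ofReal_mul_exp_I, abs_of_nonneg (ha i)]

/-- Parseval's identity for an absolutely convergent series of exponentials of period two. -/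
theorem integral_norm_sq_tsum_exp {ι : Type*} [Countable ι] {a : ι → ℝ}
    (ha : ∀ i, 0 ≤ a i) (hs : Summable a)
    (f : ι → ℤ) (t : ℝ) :
    ∫ τ in t..t + 2, ‖∑' i, (a i : ℂ) * Complex.exp ((-(Real.pi * f i * τ) : ℝ) *
        Complex.I)‖ ^ 2 =
      ∑' p : ι × ι, if f p.1 = f p.2 then 2 * (a p.1 * a p.2) else 0 := by
  have hn : ∀ τ : ℝ, Summable fun i =>
      ‖(a i : ℂ) * Complex.exp ((-(Real.pi * f i * τ) : ℝ) * Complex.I)‖ := by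
    intro τ
    simp_rw [norm_ofReal_mul_exp_I]
    simpa [abs_of_nonneg (ha _)] using hs
  have hn' : ∀ τ : ℝ, Summable fun i =>
      ‖(a i : ℂ) * Complex.exp ((Real.pi * f i * τ : ℝ) * Complex.I)‖ := by
    intro τ
    simp_rw [norm_ofReal_mul_exp_I]
    simpa [abs_of_nonneg (ha _)] using hs
  have e : ∀ τ : ℝ, ((‖∑' i, (a i : ℂ) * Complex.exp ((-(Real.pi * f i * τ) : ℝ) *
        Complex.I)‖ ^ 2 : ℝ) : ℂ) = ∑' p : ι × ι, ((a p.1 * a p.2 : ℝ) : ℂ) *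
          Complex.exp ((Real.pi * (f p.2 - f p.1) * τ : ℝ) * Complex.I) := by
    intro τ
    rw [Complex.ofReal_pow, ← Complex.mul_conj', Complex.conj_tsum]
    have : ∀ i, (starRingEnd ℂ) ((a i : ℂ) * Complex.exp ((-(Real.pi * f i * τ) : ℝ) *
        Complex.I)) = (a i : ℂ) * Complex.exp ((Real.pi * f i * τ : ℝ) * Complex.I) := by
      intro i
      rw [map_mul, Complex.conj_ofReal, ← Complex.exp_conj, map_mul, Complex.conj_ofReal,
        Complex.conj_I]
      congr 2
      push_cast
      ring
    simp_rw [this]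
    rw [tsum_mul_tsum_of_summable_norm (hn τ) (hn' τ)]
    congr 1 with p
    rw [mul_mul_mul_comm, ← Complex.exp_add]
    push_cast
    congr 2
    ring
  apply Complex.ofReal_injective
  rw [← intervalIntegral.integral_ofReal]
  simp_rw [e]
  rw [intervalIntegral.integral_of_le (by linarith),
    ← MeasureTheory.integral_tsum_of_summable_integral_norm]
  · rw [Complex.ofReal_tsum]
    congr 1 with p
    rw [← intervalIntegral.integral_of_le (by linarith), intervalIntegral.integral_const_mul]
    have h := integral_exp_two_pi_int_div two_ne_zero t (f p.2 - f p.1)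
    have h' : ∫ τ in t..t + 2,
        Complex.exp ((Real.pi * (f p.2 - f p.1) * τ : ℝ) * Complex.I) =
        if f p.2 - f p.1 = 0 then ((2 : ℝ) : ℂ) else 0 := by
      rw [← h]
      congr 1 with β
      congr 1
      push_cast
      ring
    rw [h']
    by_cases hi : f p.1 = f p.2
    · simp [hi]
      ring
    · simp [hi, sub_eq_zero, Ne.symm hi]
  · intro i
    apply Continuous.integrableOn_Ioc
    fun_prop
  · simp_rw [norm_ofReal_mul_exp_I]
    have hp : Summable fun p : ι × ι => a p.1 * a p.2 := hs.mul_of_nonneg hs ha ha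
    simpa [abs_of_nonneg, mul_nonneg, ha] using hp.mul_left 2

theorem lintegral_norm_sq_tsum_exp {ι : Type*} [Countable ι] {a : ι → ℝ}
    (ha : ∀ i, 0 ≤ a i) (hs : Summable a)
    (f : ι → ℤ) (t : ℝ) :
    ∫⁻ τ in Set.Ioc t (t + 2), ENNReal.ofReal (‖∑' i, (a i : ℂ) *
        Complex.exp ((-(Real.pi * f i * τ) : ℝ) * Complex.I)‖ ^ 2) =
      ∑' p : {p : ι × ι // f p.1 = f p.2}, ENNReal.ofReal (2 * (a p.1.1 * a p.1.2)) := by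
  have hc : Continuous fun τ : ℝ => ‖∑' i, (a i : ℂ) *
        Complex.exp ((-(Real.pi * f i * τ) : ℝ) * Complex.I)‖ ^ 2 :=
    (continuous_tsum_exp ha hs f Real.pi).norm.pow 2
  have hp : Summable fun p : ι × ι => a p.1 * a p.2 := hs.mul_of_nonneg hs ha ha
  have hp0 : ∀ p : ι × ι, 0 ≤ a p.1 * a p.2 := fun p => mul_nonneg (ha _) (ha _)
  rw [← MeasureTheory.ofReal_integral_eq_lintegral_ofReal hc.integrableOn_Ioc
      (Filter.Eventually.of_forall fun x => by positivity),
    ← intervalIntegral.integral_of_le (by linarith), integral_norm_sq_tsum_exp ha hs f t,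
    ENNReal.ofReal_tsum_of_nonneg]
  · rw [← tsum_subtype_eq_of_support_subset (s := {p : ι × ι | f p.1 = f p.2})]
    · congr 1 with p
      have : f p.1.1 = f p.1.2 := p.2
      simp [this]
    · intro p hp
      by_contra h
      exact hp (by simp [show ¬ f p.1 = f p.2 from h])
  · intro p
    have := hp0 p
    split_ifs <;> positivity
  · refine Summable.of_nonneg_of_le (fun p => ?_) (fun p => ?_) (hp.mul_left 2)
    · have := hp0 p
      split_ifs <;> positivity
    · have := hp0 p
      split_ifs
      · rfl
      · positivity

/-! ### Theta series of ℤ² and their inversion formula. -/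

/-- The theta series of `ℤ²`. -/
noncomputable def latticeTheta (z : ℂ) : ℂ :=
  ∑' v : ℤ × ℤ, Complex.exp (-(Real.pi * latticeNorm v * z))

/-- The theta series of `ℤ²` without its constant term. -/
noncomputable def puncturedTheta (z : ℂ) : ℂ :=
  ∑' v : PuncturedLattice, Complex.exp (-(Real.pi * latticeNorm v * z))

theorem norm_exp_lattice (v : ℤ × ℤ) (z : ℂ) :
    ‖Complex.exp (-(Real.pi * latticeNorm v * z))‖ =
      Real.exp (-(Real.pi * z.re * (latticeNorm v : ℝ))) := by
  rw [Complex.norm_exp]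
  congr 1
  simp
  ring

theorem summable_norm_exp_lattice {z : ℂ} (hz : 0 < z.re) :
    Summable fun v : ℤ × ℤ => ‖Complex.exp (-(Real.pi * latticeNorm v * z))‖ := by
  simp_rw [norm_exp_lattice]
  exact summable_lattice_exp (by positivity)

theorem latticeTheta_eq_one_add {z : ℂ} (hz : 0 < z.re) :
    latticeTheta z = 1 + puncturedTheta z := by
  unfold latticeTheta puncturedTheta
  rw [tsum_lattice_eq_punctured (summable_norm_exp_lattice hz).of_norm]
  simp [latticeNorm]

theorem latticeTheta_eq_jacobiTheta_sq {z : ℂ} (hz : 0 < z.re) :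
    latticeTheta z = jacobiTheta (Complex.I * z) ^ 2 := by
  have e : ∀ n : ℤ, Complex.exp (Real.pi * Complex.I * (n : ℂ) ^ 2 * (Complex.I * z)) =
      Complex.exp (-(Real.pi * (n : ℂ) ^ 2 * z)) := by
    intro n
    congr 1
    linear_combination (Real.pi * (n : ℂ) ^ 2 * z) * Complex.I_sq
  have hn : Summable fun n : ℤ => ‖Complex.exp (-(Real.pi * (n : ℂ) ^ 2 * z))‖ := by
    obtain ⟨S, hS, -⟩ := hasSum_int_exp_neg_sq (c := Real.pi * z.re) (by positivity)
    convert hS.summable using 2 with n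
    rw [Complex.norm_exp]
    congr 1
    have : ((n : ℂ) ^ 2) = (((n : ℝ) ^ 2 : ℝ) : ℂ) := by push_cast; rfl
    rw [this]
    simp only [Complex.neg_re, Complex.mul_re, Complex.ofReal_re, Complex.ofReal_im,
      Complex.mul_im]
    ring
  unfold jacobiTheta
  simp_rw [e]
  rw [sq, tsum_mul_tsum_of_summable_norm hn hn]
  unfold latticeTheta
  congr 1 with v
  rw [← Complex.exp_add]
  congr 1
  simp only [latticeNorm]
  push_cast
  ring

/-- Squaring Jacobi's functional equation turns its square-root factor into z. -/
theorem latticeTheta_inv {z : ℂ} (hz : 0 < z.re) :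
    latticeTheta z = z⁻¹ * latticeTheta z⁻¹ := by
  have hz0 : z ≠ 0 := by
    rintro rfl
    simp at hz
  have hz' : 0 < (z⁻¹).re := by
    rw [Complex.inv_re]
    exact div_pos hz (Complex.normSq_pos.2 hz0)
  rw [latticeTheta_eq_jacobiTheta_sq hz, latticeTheta_eq_jacobiTheta_sq hz',
    jacobiTheta_eq_jacobiTheta₂, jacobiTheta_eq_jacobiTheta₂, jacobiTheta₂_functional_equation]
  have e1 : -Complex.I * (Complex.I * z) = z := by linear_combination -z * Complex.I_sq
  have e2 : -1 / (Complex.I * z) = Complex.I * z⁻¹ := by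
    field_simp
    rw [Complex.I_sq]
  rw [e1, e2]
  have e3 : (z ^ (1 / 2 : ℂ)) ^ 2 = z := by
    rw [← Complex.cpow_nat_mul]
    norm_num
  simp only [ne_eq, OfNat.ofNat_ne_zero, not_false_eq_true, zero_pow, mul_zero, zero_div,
    Complex.exp_zero, mul_one]
  rw [mul_pow, div_pow, e3, one_pow, one_div]

theorem latticeTheta_eq_inv_add {z : ℂ} (hz : 0 < z.re) :
    latticeTheta z = z⁻¹ + z⁻¹ * puncturedTheta z⁻¹ := by
  have hz0 : z ≠ 0 := by
    rintro rfl
    simp at hz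
  have hz' : 0 < (z⁻¹).re := by
    rw [Complex.inv_re]
    exact div_pos hz (Complex.normSq_pos.2 hz0)
  rw [latticeTheta_inv hz, latticeTheta_eq_one_add hz']
  ring

theorem puncturedTheta_conj (z : ℂ) :
    puncturedTheta ((starRingEnd ℂ) z) = (starRingEnd ℂ) (puncturedTheta z) := by
  unfold puncturedTheta
  rw [Complex.conj_tsum]
  congr 1 with v
  rw [← Complex.exp_conj]
  simp

theorem norm_puncturedTheta_le {z : ℂ} (hz : 0 < z.re) :
    ‖puncturedTheta z‖ ≤ 80 / (Real.pi * z.re) * Real.exp (-(Real.pi * z.re / 4)) := by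
  have hs : Summable fun v : PuncturedLattice =>
      ‖Complex.exp (-(Real.pi * latticeNorm v * z))‖ :=
    (summable_norm_exp_lattice hz).comp_injective Subtype.val_injective
  refine (norm_tsum_le_tsum_norm hs).trans ?_
  simp_rw [norm_exp_lattice]
  exact tsum_punctured_exp_le_exp (by positivity)

/-! ### Mean square of the punctured theta series, uniformly in the real part. -/

theorem lattice_mul_exp_le {c : ℝ} (hc : 0 < c) (v : PuncturedLattice) :
    (latticeNorm v : ℝ) * Real.exp (-(c * (latticeNorm v : ℝ))) ≤
      2 / c * Real.exp (-(c / 2 * (latticeNorm v : ℝ))) := by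
  have h := Real.add_one_le_exp (c / 2 * (latticeNorm v : ℝ))
  have h1 : (latticeNorm v : ℝ) ≤ 2 / c * Real.exp (c / 2 * (latticeNorm v : ℝ)) := by
    rw [div_mul_eq_mul_div, le_div_iff₀ hc]
    linarith
  calc _ ≤ 2 / c * Real.exp (c / 2 * (latticeNorm v : ℝ)) *
        Real.exp (-(c * (latticeNorm v : ℝ))) :=
        mul_le_mul_of_nonneg_right h1 (Real.exp_pos _).le
    _ = _ := by
        rw [mul_assoc, ← Real.exp_add]
        ring_nf

theorem summable_lattice_mul_exp {ρ : ℝ} (hρ : 0 < ρ) :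
    Summable fun v : PuncturedLattice => Real.pi * (latticeNorm v : ℝ) *
      Real.exp (-(Real.pi * ρ * (latticeNorm v : ℝ))) := by
  have hc : 0 < Real.pi * ρ := by positivity
  have h := ((summable_punctured_exp (half_pos hc)).mul_left (2 / (Real.pi * ρ))).mul_left Real.pi
  refine Summable.of_nonneg_of_le (fun v => ?_) (fun v => ?_) h
  · have := one_le_latticeNorm_real v
    positivity
  · rw [mul_assoc]
    exact mul_le_mul_of_nonneg_left (lattice_mul_exp_le hc v) Real.pi_pos.le

/-- The coefficients of minus the derivative of `puncturedTheta` on the line `re z = max σ ρ`. -/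
noncomputable def derivCoeff (ρ σ : ℝ) (v : PuncturedLattice) : ℝ :=
  Real.pi * (latticeNorm v : ℝ) * Real.exp (-(Real.pi * max σ ρ * (latticeNorm v : ℝ)))

/-- Minus the derivative of `puncturedTheta` at `max σ ρ + τ i`. -/
noncomputable def derivSeries (ρ σ τ : ℝ) : ℂ :=
  ∑' v : PuncturedLattice, (derivCoeff ρ σ v : ℂ) *
    Complex.exp ((-(Real.pi * (latticeNorm v : ℤ) * τ) : ℝ) * Complex.I)

theorem derivCoeff_nonneg (ρ σ : ℝ) (v : PuncturedLattice) : 0 ≤ derivCoeff ρ σ v := by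
  have := one_le_latticeNorm_real v
  unfold derivCoeff
  positivity

theorem derivCoeff_le (ρ σ : ℝ) (v : PuncturedLattice) :
    derivCoeff ρ σ v ≤ Real.pi * (latticeNorm v : ℝ) *
      Real.exp (-(Real.pi * ρ * (latticeNorm v : ℝ))) := by
  have := one_le_latticeNorm_real v
  unfold derivCoeff
  gcongr
  exact le_max_right _ _

theorem summable_derivCoeff {ρ : ℝ} (hρ : 0 < ρ) (σ : ℝ) : Summable (derivCoeff ρ σ) :=
  Summable.of_nonneg_of_le (derivCoeff_nonneg ρ σ) (derivCoeff_le ρ σ)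
    (summable_lattice_mul_exp hρ)

/-- The truncation `max σ ρ` supplies a summable majorant independent of σ, so joint continuity
holds on the whole plane. -/
theorem continuous_derivSeries {ρ : ℝ} (hρ : 0 < ρ) :
    Continuous fun p : ℝ × ℝ => derivSeries ρ p.1 p.2 := by
  unfold derivSeries
  refine continuous_tsum (fun v => ?_) (summable_lattice_mul_exp hρ) fun v p => ?_
  · unfold derivCoeff
    fun_prop
  · rw [norm_ofReal_mul_exp_I, abs_of_nonneg (derivCoeff_nonneg _ _ _)]
    exact derivCoeff_le _ _ _

theorem puncturedTheta_mk (ρ τ : ℝ) :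
    puncturedTheta (ρ + τ * Complex.I) =
      ∑' v : PuncturedLattice, ((Real.exp (-(Real.pi * ρ * (latticeNorm v : ℝ))) : ℝ) : ℂ) *
        Complex.exp ((-(Real.pi * (latticeNorm v : ℤ) * τ) : ℝ) * Complex.I) := by
  unfold puncturedTheta
  congr 1 with v
  rw [Complex.ofReal_exp, ← Complex.exp_add]
  congr 1
  push_cast
  ring

theorem integral_derivCoeff {ρ a b : ℝ} (ha : ρ ≤ a) (hab : a ≤ b) (v : PuncturedLattice) :
    ∫ σ in a..b, derivCoeff ρ σ v = Real.exp (-(Real.pi * a * (latticeNorm v : ℝ))) -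
      Real.exp (-(Real.pi * b * (latticeNorm v : ℝ))) := by
  have h1 : ∫ σ in a..b, derivCoeff ρ σ v = ∫ σ in a..b, Real.pi * (latticeNorm v : ℝ) *
      Real.exp (-(Real.pi * σ * (latticeNorm v : ℝ))) := by
    refine intervalIntegral.integral_congr fun σ hσ => ?_
    rw [Set.uIcc_of_le hab] at hσ
    simp only [derivCoeff, max_eq_left (ha.trans hσ.1)]
  rw [h1, intervalIntegral.integral_eq_sub_of_hasDerivAt
    (f := fun σ => -Real.exp (-(Real.pi * σ * (latticeNorm v : ℝ))))]
  · ring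
  · intro σ _
    have : HasDerivAt (fun σ : ℝ => -(Real.pi * σ * (latticeNorm v : ℝ)))
        (-(Real.pi * 1 * (latticeNorm v : ℝ))) σ :=
      (((hasDerivAt_id σ).const_mul Real.pi).mul_const _).neg
    have h2 : HasDerivAt (fun σ : ℝ => -Real.exp (-(Real.pi * σ * (latticeNorm v : ℝ)))) _ σ :=
      this.exp.neg
    exact h2.congr_deriv (by ring)
  · apply Continuous.intervalIntegrable
    fun_prop

theorem puncturedTheta_sub_eq_integral {ρ a b : ℝ} (hρ : 0 < ρ) (ha : ρ ≤ a) (hab : a ≤ b)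
    (τ : ℝ) :
    ∫ σ in a..b, derivSeries ρ σ τ =
      puncturedTheta (a + τ * Complex.I) - puncturedTheta (b + τ * Complex.I) := by
  have hs : ∀ c : ℝ, 0 < c → Summable fun v : PuncturedLattice =>
      ((Real.exp (-(Real.pi * c * (latticeNorm v : ℝ))) : ℝ) : ℂ) *
        Complex.exp ((-(Real.pi * (latticeNorm v : ℤ) * τ) : ℝ) * Complex.I) := by
    intro c hc
    apply Summable.of_norm
    simp_rw [norm_ofReal_mul_exp_I, abs_of_pos (Real.exp_pos _)]
    exact summable_punctured_exp (by positivity)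
  have ha0 := hρ.trans_le ha
  rw [puncturedTheta_mk, puncturedTheta_mk, ← (hs a ha0).tsum_sub (hs b (ha0.trans_le hab)),
    intervalIntegral.integral_of_le hab]
  unfold derivSeries
  rw [← MeasureTheory.integral_tsum_of_summable_integral_norm]
  · congr 1 with v
    rw [MeasureTheory.integral_mul_const, integral_complex_ofReal,
      ← intervalIntegral.integral_of_le hab, integral_derivCoeff ha hab]
    push_cast
    ring
  · intro v
    apply Continuous.integrableOn_Ioc
    unfold derivCoeff
    fun_prop
  · simp_rw [norm_ofReal_mul_exp_I, abs_of_nonneg (derivCoeff_nonneg _ _ _),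
      ← intervalIntegral.integral_of_le hab, integral_derivCoeff ha hab]
    exact (summable_punctured_exp (c := Real.pi * a) (by positivity)).sub
      (summable_punctured_exp (c := Real.pi * b) (by have := ha0.trans_le hab; positivity))

/-- Cauchy-Schwarz against the constant 1, from ∫ ((b-a)f - m)² ≥ 0 with m = ∫ f. -/
theorem sq_integral_le {f : ℝ → ℝ} (hf : Continuous f) {a b : ℝ} (hab : a ≤ b) :
    (∫ σ in a..b, f σ) ^ 2 ≤ (b - a) * ∫ σ in a..b, f σ ^ 2 := by
  rcases hab.eq_or_lt with rfl | h
  · simp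
  · have hba : 0 < b - a := sub_pos.2 h
    set m := ∫ σ in a..b, f σ
    have h0 : 0 ≤ ∫ σ in a..b, ((b - a) * f σ - m) ^ 2 :=
      intervalIntegral.integral_nonneg hab fun σ _ => sq_nonneg _
    have e : ∀ σ, ((b - a) * f σ - m) ^ 2 =
        (b - a) ^ 2 * f σ ^ 2 - 2 * (b - a) * m * f σ + m ^ 2 := fun σ => by ring
    simp_rw [e] at h0
    have hi1 : IntervalIntegrable (fun σ => (b - a) ^ 2 * f σ ^ 2) MeasureTheory.volume a b :=
      Continuous.intervalIntegrable (by fun_prop) _ _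
    have hi2 : IntervalIntegrable (fun σ => 2 * (b - a) * m * f σ) MeasureTheory.volume a b :=
      Continuous.intervalIntegrable (by fun_prop) _ _
    rw [intervalIntegral.integral_add (hi1.sub hi2) (by simp),
      intervalIntegral.integral_sub hi1 hi2, intervalIntegral.integral_const_mul,
      intervalIntegral.integral_const_mul, intervalIntegral.integral_const, smul_eq_mul] at h0
    have : 0 ≤ (b - a) * ((b - a) * ∫ σ in a..b, f σ ^ 2) - (b - a) * m ^ 2 := by
      linarith
    rw [← mul_sub] at this
    linarith [nonneg_of_mul_nonneg_right this hba]

/-- A bound for `‖puncturedTheta‖²` that is uniform for real parts in `[ρ, 5ρ]`. -/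
noncomputable def thetaMajorant (ρ τ : ℝ) : ℝ :=
  2 * ‖puncturedTheta (((5 * ρ : ℝ) : ℂ) + τ * Complex.I)‖ ^ 2 +
    8 * ρ * ∫ σ in ρ..5 * ρ, ‖derivSeries ρ σ τ‖ ^ 2

/-- The value at real part ρ' differs from the one at 5ρ by an integral of the derivative. The
coefficients 2 and 8ρ come from (A+B)² ≤ 2A² + 2B² and Cauchy-Schwarz on an interval of length 4ρ.
-/
theorem norm_sq_puncturedTheta_le_majorant {ρ ρ' : ℝ} (hρ : 0 < ρ) (h1 : ρ ≤ ρ')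
    (h2 : ρ' ≤ 5 * ρ) (τ : ℝ) :
    ‖puncturedTheta (ρ' + τ * Complex.I)‖ ^ 2 ≤ thetaMajorant ρ τ := by
  have hcont : Continuous fun σ => ‖derivSeries ρ σ τ‖ :=
    ((continuous_derivSeries hρ).comp (by fun_prop : Continuous fun σ : ℝ => (σ, τ))).norm
  have hI := puncturedTheta_sub_eq_integral hρ h1 h2 τ
  have hle : ‖∫ σ in ρ'..5 * ρ, derivSeries ρ σ τ‖ ≤ ∫ σ in ρ..5 * ρ, ‖derivSeries ρ σ τ‖ := by
    refine (intervalIntegral.norm_integral_le_integral_norm h2).trans ?_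
    exact intervalIntegral.integral_mono_interval h1 h2 le_rfl
      (Filter.Eventually.of_forall fun σ => norm_nonneg _) (hcont.intervalIntegrable _ _)
  have hsq := sq_integral_le hcont (by linarith : ρ ≤ 5 * ρ)
  have htri : ‖puncturedTheta (ρ' + τ * Complex.I)‖ ≤
      ‖puncturedTheta (((5 * ρ : ℝ) : ℂ) + τ * Complex.I)‖ +
        ∫ σ in ρ..5 * ρ, ‖derivSeries ρ σ τ‖ := by
    have : puncturedTheta (ρ' + τ * Complex.I) =
        puncturedTheta (((5 * ρ : ℝ) : ℂ) + τ * Complex.I) +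
          ∫ σ in ρ'..5 * ρ, derivSeries ρ σ τ := by
      rw [hI]; ring
    rw [this]
    exact (norm_add_le _ _).trans (add_le_add le_rfl hle)
  set A := ‖puncturedTheta (((5 * ρ : ℝ) : ℂ) + τ * Complex.I)‖
  set B := ∫ σ in ρ..5 * ρ, ‖derivSeries ρ σ τ‖
  have hA : ‖puncturedTheta (ρ' + τ * Complex.I)‖ ^ 2 ≤ (A + B) ^ 2 :=
    pow_le_pow_left₀ (norm_nonneg _) htri 2
  unfold thetaMajorant
  nlinarith [sq_nonneg (A - B)]

theorem lintegral_norm_sq_puncturedTheta_le {ρ : ℝ} (hρ : 0 < ρ) (t : ℝ) :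
    ∫⁻ τ in Set.Ioc t (t + 2), ENNReal.ofReal
        (‖puncturedTheta (((5 * ρ : ℝ) : ℂ) + τ * Complex.I)‖ ^ 2) ≤
      ENNReal.ofReal 2 * equalNormSum (Real.pi * ρ) := by
  simp_rw [puncturedTheta_mk]
  rw [lintegral_norm_sq_tsum_exp (fun v => (Real.exp_pos _).le)
    (summable_punctured_exp (by positivity)) (fun v : PuncturedLattice => latticeNorm v),
    equalNormSum, ← ENNReal.tsum_mul_left]
  refine ENNReal.tsum_le_tsum fun p => ?_
  rw [← ENNReal.ofReal_mul (by norm_num), ← Real.exp_add]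
  apply ENNReal.ofReal_le_ofReal
  have h1 := one_le_latticeNorm_real p.1.1
  have h2 := one_le_latticeNorm_real p.1.2
  have : 0 < Real.pi * ρ := by positivity
  gcongr
  nlinarith

theorem sq_mul_exp_neg_two_mul_le {y : ℝ} (hy : 0 ≤ y) :
    y ^ 2 * Real.exp (-(2 * y)) ≤ 4 * Real.exp (-y) := by
  have h := Real.add_one_le_exp (y / 2)
  have h2 : y ^ 2 ≤ 4 * Real.exp y := by
    rw [show y = y / 2 + y / 2 by ring, Real.exp_add]
    nlinarith
  calc _ ≤ 4 * Real.exp y * Real.exp (-(2 * y)) :=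
        mul_le_mul_of_nonneg_right h2 (Real.exp_pos _).le
    _ = _ := by
        rw [mul_assoc, ← Real.exp_add]
        ring_nf

/-- Half of the exponential decay absorbs the factor (π|v|²)² at the price of ρ⁻². The weight 8ρ and
the length 4ρ of the σ-interval in `thetaMajorant` compensate for it. -/
theorem lintegral_norm_sq_derivSeries_le {ρ : ℝ} (hρ : 0 < ρ) (σ t : ℝ) :
    ∫⁻ τ in Set.Ioc t (t + 2), ENNReal.ofReal (‖derivSeries ρ σ τ‖ ^ 2) ≤
      ENNReal.ofReal (8 / ρ ^ 2) * equalNormSum (Real.pi * ρ) := by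
  unfold derivSeries
  rw [lintegral_norm_sq_tsum_exp (derivCoeff_nonneg ρ σ) (summable_derivCoeff hρ σ)
    (fun v : PuncturedLattice => latticeNorm v), equalNormSum, ← ENNReal.tsum_mul_left]
  refine ENNReal.tsum_le_tsum fun p => ?_
  rw [← ENNReal.ofReal_mul (by positivity)]
  apply ENNReal.ofReal_le_ofReal
  have h1 := derivCoeff_le ρ σ p.1.1
  have h2 := derivCoeff_le ρ σ p.1.2
  have hN : latticeNorm p.1.1 = latticeNorm p.1.2 := p.2
  have hN1 := one_le_latticeNorm_real p.1.1
  rw [← hN] at h2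
  set N : ℝ := (latticeNorm p.1.1 : ℝ)
  have h3 := mul_le_mul h1 h2 (derivCoeff_nonneg _ _ _) (by positivity)
  have h4 := sq_mul_exp_neg_two_mul_le (y := Real.pi * ρ * N) (by positivity)
  calc _ ≤ 2 * (Real.pi * N * Real.exp (-(Real.pi * ρ * N)) *
        (Real.pi * N * Real.exp (-(Real.pi * ρ * N)))) := by linarith
    _ = 2 / ρ ^ 2 * ((Real.pi * ρ * N) ^ 2 * Real.exp (-(2 * (Real.pi * ρ * N)))) := by
        rw [show -(2 * (Real.pi * ρ * N)) = -(Real.pi * ρ * N) + -(Real.pi * ρ * N) by ring,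
          Real.exp_add]
        field_simp
    _ ≤ 2 / ρ ^ 2 * (4 * Real.exp (-(Real.pi * ρ * N))) :=
        mul_le_mul_of_nonneg_left h4 (by positivity)
    _ = _ := by ring

theorem ofReal_thetaMajorant {ρ : ℝ} (hρ : 0 < ρ) (τ : ℝ) :
    ENNReal.ofReal (thetaMajorant ρ τ) =
      ENNReal.ofReal 2 * ENNReal.ofReal
        (‖puncturedTheta (((5 * ρ : ℝ) : ℂ) + τ * Complex.I)‖ ^ 2) +
      ENNReal.ofReal (8 * ρ) * ∫⁻ σ in Set.Ioc ρ (5 * ρ),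
        ENNReal.ofReal (‖derivSeries ρ σ τ‖ ^ 2) := by
  have hc : Continuous fun σ => ‖derivSeries ρ σ τ‖ ^ 2 :=
    ((continuous_derivSeries hρ).comp (by fun_prop : Continuous fun σ : ℝ => (σ, τ))).norm.pow 2
  have hle : ρ ≤ 5 * ρ := by linarith
  have hI : 0 ≤ ∫ σ in ρ..5 * ρ, ‖derivSeries ρ σ τ‖ ^ 2 :=
    intervalIntegral.integral_nonneg hle fun σ _ => by positivity
  rw [← MeasureTheory.ofReal_integral_eq_lintegral_ofReal hc.integrableOn_Ioc
    (Filter.Eventually.of_forall fun x => sq_nonneg _),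
    ← intervalIntegral.integral_of_le hle, ← ENNReal.ofReal_mul zero_le_two,
    ← ENNReal.ofReal_mul (mul_nonneg (by norm_num) hρ.le), thetaMajorant,
    ENNReal.ofReal_add (by positivity) (mul_nonneg (by positivity) hI)]

theorem continuous_puncturedTheta_line {ρ : ℝ} (hρ : 0 < ρ) :
    Continuous fun τ : ℝ => puncturedTheta ((ρ : ℂ) + τ * Complex.I) := by
  simp_rw [puncturedTheta_mk]
  exact continuous_tsum_exp (fun v : PuncturedLattice =>
      (Real.exp_pos (-(Real.pi * ρ * (latticeNorm v : ℝ)))).le)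
      (summable_punctured_exp (by positivity)) (fun v : PuncturedLattice => latticeNorm v) Real.pi

theorem lintegral_lintegral_derivSeries_le {ρ : ℝ} (hρ : 0 < ρ) (t : ℝ) :
    ∫⁻ τ in Set.Ioc t (t + 2), ∫⁻ σ in Set.Ioc ρ (5 * ρ),
        ENNReal.ofReal (‖derivSeries ρ σ τ‖ ^ 2) ≤
      ENNReal.ofReal (8 / ρ ^ 2) * equalNormSum (Real.pi * ρ) * ENNReal.ofReal (4 * ρ) := by
  have hcont : Continuous fun p : ℝ × ℝ => ENNReal.ofReal (‖derivSeries ρ p.2 p.1‖ ^ 2) :=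
    ENNReal.continuous_ofReal.comp (((continuous_derivSeries hρ).comp continuous_swap).norm.pow 2)
  rw [MeasureTheory.lintegral_lintegral_swap hcont.measurable.aemeasurable]
  refine (MeasureTheory.lintegral_mono fun σ =>
    lintegral_norm_sq_derivSeries_le hρ σ t).trans (le_of_eq ?_)
  rw [MeasureTheory.setLIntegral_const, Real.volume_Ioc]
  congr 2
  ring

theorem lintegral_thetaMajorant_le {ρ : ℝ} (hρ : 0 < ρ) (t : ℝ) :
    ∫⁻ τ in Set.Ioc t (t + 2), ENNReal.ofReal (thetaMajorant ρ τ) ≤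
      ENNReal.ofReal 260 * equalNormSum (Real.pi * ρ) := by
  have hm : Measurable fun τ : ℝ => ENNReal.ofReal 2 * ENNReal.ofReal
        (‖puncturedTheta (((5 * ρ : ℝ) : ℂ) + τ * Complex.I)‖ ^ 2) := by
    have h := (continuous_puncturedTheta_line (ρ := 5 * ρ) (by positivity)).measurable
    exact ((h.norm.pow_const 2).ennreal_ofReal).const_mul _
  simp_rw [ofReal_thetaMajorant hρ]
  rw [MeasureTheory.lintegral_add_left hm,
    MeasureTheory.lintegral_const_mul' _ _ ENNReal.ofReal_ne_top,
    MeasureTheory.lintegral_const_mul' _ _ ENNReal.ofReal_ne_top]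
  calc _ ≤ ENNReal.ofReal 2 * (ENNReal.ofReal 2 * equalNormSum (Real.pi * ρ)) +
        ENNReal.ofReal (8 * ρ) * (ENNReal.ofReal (8 / ρ ^ 2) * equalNormSum (Real.pi * ρ) *
          ENNReal.ofReal (4 * ρ)) :=
        add_le_add (mul_le_mul_right (lintegral_norm_sq_puncturedTheta_le hρ t) _)
          (mul_le_mul_right (lintegral_lintegral_derivSeries_le hρ t) _)
    _ = (ENNReal.ofReal 2 * ENNReal.ofReal 2 + ENNReal.ofReal (8 * ρ) *
          ENNReal.ofReal (8 / ρ ^ 2) * ENNReal.ofReal (4 * ρ)) * equalNormSum (Real.pi * ρ) := by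
        ring
    _ = _ := by
        rw [← ENNReal.ofReal_mul (by norm_num), ← ENNReal.ofReal_mul (by positivity),
          ← ENNReal.ofReal_mul (by positivity), ← ENNReal.ofReal_add (by positivity)
            (by positivity)]
        -- 260 = 2·2 + 8·8·4.
        congr 2
        field_simp
        norm_num

/-! ### Change of variable under inversion and decomposition into strips. -/

/-- Minus the imaginary part of `(α + 2 β i)⁻¹`. -/
noncomputable def inversionHeight (α β : ℝ) : ℝ := 2 * β / (α ^ 2 + 4 * β ^ 2)

theorem norm_sq_inv_mk (α β : ℝ) :
    ‖((α : ℂ) + ((2 * β : ℝ) : ℂ) * Complex.I)⁻¹‖ ^ 2 = 1 / (α ^ 2 + 4 * β ^ 2) := by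
  rw [norm_inv, inv_pow, ← Complex.normSq_eq_norm_sq, Complex.normSq_add_mul_I, one_div]
  congr 1
  ring

theorem inv_mk_eq (α β : ℝ) :
    ((α : ℂ) + ((2 * β : ℝ) : ℂ) * Complex.I)⁻¹ = (starRingEnd ℂ)
      (((α / (α ^ 2 + 4 * β ^ 2) : ℝ) : ℂ) + (inversionHeight α β : ℝ) * Complex.I) := by
  rw [Complex.inv_def, Complex.normSq_add_mul_I]
  unfold inversionHeight
  simp only [map_add, map_mul, Complex.conj_ofReal, Complex.conj_I]
  push_cast
  ring

theorem norm_puncturedTheta_inv_mk (α β : ℝ) :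
    ‖puncturedTheta ((α : ℂ) + ((2 * β : ℝ) : ℂ) * Complex.I)⁻¹‖ =
      ‖puncturedTheta (((α / (α ^ 2 + 4 * β ^ 2) : ℝ) : ℂ) +
        (inversionHeight α β : ℝ) * Complex.I)‖ := by
  rw [inv_mk_eq, puncturedTheta_conj, RCLike.norm_conj]

theorem hasDerivAt_inversionHeight {α : ℝ} (hα : 0 < α) (β : ℝ) :
    HasDerivAt (inversionHeight α)
      ((2 * α ^ 2 - 8 * β ^ 2) / (α ^ 2 + 4 * β ^ 2) ^ 2) β := by
  have h1 : HasDerivAt (fun β : ℝ => 2 * β) (2 * 1) β := (hasDerivAt_id β).const_mul 2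
  have h2 : HasDerivAt (fun β : ℝ => α ^ 2 + 4 * β ^ 2) (4 * (2 * β)) β := by
    have := ((hasDerivAt_pow 2 β).const_mul 4).const_add (α ^ 2)
    simpa using this
  have h3 := h1.div h2 (by positivity)
  refine h3.congr_deriv ?_
  congr 1
  ring

/-- Equal heights at a and b force (a-b)(4ab-α²) = 0, and 4ab > α² here. -/
theorem injOn_inversionHeight {α : ℝ} (hα : 0 < α) :
    Set.InjOn (inversionHeight α) (Set.Ici α) := by
  intro a ha b hb h
  have ha : α ≤ a := ha
  have hb : α ≤ b := hb
  unfold inversionHeight at h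
  rw [div_eq_div_iff (by positivity) (by positivity)] at h
  have h2 : (a - b) * (4 * (a * b) - α ^ 2) = 0 := by linarith
  have h3 : α * α ≤ a * b := mul_le_mul ha hb hα.le (hα.le.trans ha)
  rcases mul_eq_zero.1 h2 with h4 | h4
  · linarith
  · nlinarith

/-- The weight of a window of `L` integers at frequency `β`. -/
noncomputable def windowWeight (L β : ℝ) : ℝ := min (L ^ 2) (1 / (4 * β ^ 2))

theorem windowWeight_nonneg (L β : ℝ) : 0 ≤ windowWeight L β :=
  le_min (sq_nonneg _) (by positivity)

/-- Let D = |w|² = α² + 4β² and let τ be the height. For β ≥ α, τ² ≤ 1/D ≤ (5/4)τ², while k²/4 ≤ τ²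
≤ k². Hence the real part α/D of w⁻¹ lies between αk²/4 and five times that value, the range covered
by the majorant. -/
theorem integrand_le_majorant {α β L k : ℝ} (hα : 0 < α) (hβ : α ≤ β) (hk : 1 ≤ k)
    (h1 : k / 2 ≤ inversionHeight α β) (h2 : inversionHeight α β ≤ (k + 1) / 2) :
    ‖((α : ℂ) + ((2 * β : ℝ) : ℂ) * Complex.I)⁻¹‖ ^ 2 *
        ‖puncturedTheta ((α : ℂ) + ((2 * β : ℝ) : ℂ) * Complex.I)⁻¹‖ ^ 2 * windowWeight L β ≤
      |(2 * α ^ 2 - 8 * β ^ 2) / (α ^ 2 + 4 * β ^ 2) ^ 2| *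
        (2 * min (L ^ 2) (k ^ 2) *
          thetaMajorant (α * k ^ 2 / 4) (inversionHeight α β)) := by
  have hβ0 : 0 < β := hα.trans_le hβ
  rw [norm_sq_inv_mk, norm_puncturedTheta_inv_mk]
  set D := α ^ 2 + 4 * β ^ 2 with hD
  have hD0 : 0 < D := by positivity
  have hαβ : α ^ 2 ≤ β ^ 2 := pow_le_pow_left₀ hα.le hβ 2
  have hτ : inversionHeight α β = 2 * β / D := rfl
  set τ := inversionHeight α β
  have hτD : τ * D = 2 * β := by rw [hτ]; field_simp
  have hτ2 : τ ^ 2 * D ^ 2 = 4 * β ^ 2 := by rw [← mul_pow, hτD]; ring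
  have hDle : 4 * D ≤ 5 * (τ ^ 2 * D ^ 2) := by rw [hτ2]; linarith
  have hDge : τ ^ 2 * D ^ 2 ≤ D := by rw [hτ2, hD]; nlinarith
  have hk1 : k ^ 2 / 4 ≤ τ ^ 2 := by
    have := pow_le_pow_left₀ (by positivity) h1 2
    linarith [this, (by ring : (k / 2) ^ 2 = k ^ 2 / 4)]
  have hk2 : τ ^ 2 ≤ k ^ 2 := pow_le_pow_left₀ (by linarith) (h2.trans (by linarith)) 2
  have hi1 : τ ^ 2 ≤ 1 / D := by
    rw [le_div_iff₀ hD0]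
    have : τ ^ 2 * D * D ≤ 1 * D := by linarith [hDge, (by ring : τ ^ 2 * D * D = τ ^ 2 * D ^ 2)]
    exact le_of_mul_le_mul_right this hD0
  have hi2 : 1 / D ≤ 5 / 4 * τ ^ 2 := by
    rw [div_le_iff₀ hD0]
    have : 1 * D ≤ 5 / 4 * τ ^ 2 * D * D := by
      linarith [(by ring : 5 / 4 * τ ^ 2 * D * D = 5 / 4 * (τ ^ 2 * D ^ 2))]
    exact le_of_mul_le_mul_right this hD0
  have hP := norm_sq_puncturedTheta_le_majorant (ρ := α * k ^ 2 / 4) (ρ' := α / D)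
    (by positivity) (by rw [div_eq_mul_one_div α D]; nlinarith)
    (by rw [div_eq_mul_one_div α D]; nlinarith) τ
  have hW : windowWeight L β ≤ 2 * min (L ^ 2) (k ^ 2) := by
    have h4 : 1 / (4 * β ^ 2) ≤ 2 * k ^ 2 := by
      rw [← hτ2]
      have h5 : 1 / (τ ^ 2 * D ^ 2) ≤ 5 / 4 * (1 / D) := by
        rw [div_le_iff₀ (by rw [hτ2]; positivity)]
        have : 5 / 4 * (1 / D) * (τ ^ 2 * D ^ 2) = 5 * (τ ^ 2 * D ^ 2) / (4 * D) := by
          field_simp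
        rw [this, le_div_iff₀ (by positivity)]
        linarith
      nlinarith
    rw [mul_min_of_nonneg _ _ (by norm_num)]
    exact min_le_min (by nlinarith [sq_nonneg L]) h4
  -- The Jacobian dominates |w|⁻², since 4β² ≥ 3α².
  have hd : 1 / D ≤ |(2 * α ^ 2 - 8 * β ^ 2) / D ^ 2| := by
    rw [abs_div, abs_of_pos (by positivity : 0 < D ^ 2), abs_of_nonpos (by nlinarith),
      div_le_div_iff₀ hD0 (by positivity)]
    have : D ≤ -(2 * α ^ 2 - 8 * β ^ 2) + 0 := by rw [hD]; nlinarith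
    nlinarith
  rw [mul_assoc]
  have hQ : 0 ≤ thetaMajorant (α * k ^ 2 / 4) τ := (sq_nonneg _).trans hP
  refine mul_le_mul hd ?_ (mul_nonneg (sq_nonneg _) (windowWeight_nonneg _ _)) (abs_nonneg _)
  rw [mul_comm]
  exact mul_le_mul hW hP (sq_nonneg _) (by positivity)

/-- The terms are 1 up to about L and then L²/(k+1)²; both ranges are dominated by the telescoping
4L²/((L+k)(L+k+1)). -/
theorem sum_le_of_le_mul_telescope {L : ℝ} (hL : 1 ≤ L) :
    ∑' k : ℕ, ENNReal.ofReal (min (L ^ 2) (((k : ℝ) + 1) ^ 2) / ((k : ℝ) + 1) ^ 2) ≤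
      ENNReal.ofReal (4 * L) := by
  have hterm : ∀ k : ℕ, min (L ^ 2) (((k : ℝ) + 1) ^ 2) / ((k : ℝ) + 1) ^ 2 ≤
      4 * L ^ 2 * (1 / (L + k) - 1 / (L + ((k + 1 : ℕ) : ℝ))) := by
    intro k
    have hk : (0 : ℝ) ≤ k := k.cast_nonneg
    have e : 4 * L ^ 2 * (1 / (L + k) - 1 / (L + ((k + 1 : ℕ) : ℝ))) =
        4 * L ^ 2 / ((L + k) * (L + k + 1)) := by
      push_cast
      field_simp
      ring
    rw [e, div_le_div_iff₀ (by positivity) (by positivity)]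
    rcases le_total L ((k : ℝ) + 1) with h | h
    · have h1 : (L + k) * (L + k + 1) ≤ 4 * ((k : ℝ) + 1) ^ 2 := by nlinarith
      calc _ ≤ L ^ 2 * (4 * ((k : ℝ) + 1) ^ 2) :=
            mul_le_mul (min_le_left _ _) h1 (by positivity) (by positivity)
        _ = _ := by ring
    · have h1 : (L + k) * (L + k + 1) ≤ 4 * L ^ 2 := by nlinarith
      calc _ ≤ ((k : ℝ) + 1) ^ 2 * (4 * L ^ 2) :=
            mul_le_mul (min_le_right _ _) h1 (by positivity) (by positivity)
        _ = _ := by ring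
  have hnn : ∀ k : ℕ, 0 ≤ min (L ^ 2) (((k : ℝ) + 1) ^ 2) / ((k : ℝ) + 1) ^ 2 := fun k => by
    positivity
  have hpart : ∀ N : ℕ, ∑ k ∈ Finset.range N,
      min (L ^ 2) (((k : ℝ) + 1) ^ 2) / ((k : ℝ) + 1) ^ 2 ≤ 4 * L := by
    intro N
    refine (Finset.sum_le_sum fun k _ => hterm k).trans ?_
    rw [← Finset.mul_sum, Finset.sum_range_sub' (fun k : ℕ => 1 / (L + (k : ℝ)))]
    have h0 : 0 ≤ 1 / (L + (N : ℝ)) := by positivity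
    calc _ ≤ 4 * L ^ 2 * (1 / L) := by
          apply mul_le_mul_of_nonneg_left _ (by positivity)
          simp only [Nat.cast_zero, add_zero]
          linarith
      _ = 4 * L := by field_simp
  rw [← ENNReal.ofReal_tsum_of_nonneg hnn (summable_of_sum_range_le hnn hpart)]
  exact ENNReal.ofReal_le_ofReal (Real.tsum_le_of_sum_range_le hnn hpart)

theorem log_two_add_le {x k : ℝ} (hx : 3 ≤ x) (hk : 1 ≤ k) :
    Real.log (2 + 16 / (Real.pi * (1 / x * k ^ 2 / 4))) ≤ 5 * Real.log x := by
  have hx0 : 0 < x := by linarith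
  have h1 : 16 / (Real.pi * (1 / x * k ^ 2 / 4)) ≤ 64 * x := by
    have hd : 1 / (4 * x) ≤ Real.pi * (1 / x * k ^ 2 / 4) := by
      have hk2 : 1 ≤ k ^ 2 := one_le_pow₀ hk
      have hpi : 1 ≤ Real.pi := by linarith [Real.pi_gt_three]
      calc 1 / (4 * x) = 1 * (1 / x * 1 / 4) := by field_simp
        _ ≤ _ := by gcongr
    calc _ ≤ 16 / (1 / (4 * x)) := by gcongr
      _ = _ := by field_simp; norm_num
  have h2 : 2 + 64 * x ≤ x ^ 5 := by
    have h3 : (3 : ℝ) ^ 4 ≤ x ^ 4 := pow_le_pow_left₀ (by norm_num) hx 4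
    nlinarith
  calc _ ≤ Real.log (x ^ 5) := Real.log_le_log (by positivity) (by linarith)
    _ = _ := by rw [Real.log_pow]; norm_num

/-- The set of frequencies whose height under inversion lies in a given interval. -/
def heightStrip (α : ℝ) (k : ℕ) : Set ℝ :=
  Set.Icc α (1 / 2) ∩ inversionHeight α ⁻¹' Set.Ioc (((k : ℝ) + 1) / 2) (((k : ℝ) + 1 + 1) / 2)

theorem Icc_subset_iUnion_heightStrip {α : ℝ} (hα : 0 < α) (hα' : α ≤ 1 / 3) :
    Set.Icc α (1 / 2) ⊆ ⋃ k : ℕ, heightStrip α k := by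
  intro β hβ
  have hβ0 : 0 < β := hα.trans_le hβ.1
  have hτ : 1 / 2 < inversionHeight α β := by
    unfold inversionHeight
    rw [div_lt_div_iff₀ (by norm_num) (by positivity)]
    nlinarith [hβ.1, hβ.2]
  set τ := inversionHeight α β with hτdef
  have hc : 1 < ⌈2 * τ⌉₊ := by
    rw [Nat.lt_ceil]
    push_cast
    linarith
  -- Strip k corresponds to 2τ in (k+1, k+2], hence the shift by two from the ceiling.
  obtain ⟨k, hk⟩ : ∃ k : ℕ, ⌈2 * τ⌉₊ = k + 2 := ⟨⌈2 * τ⌉₊ - 2, by omega⟩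
  have h1 : 2 * τ ≤ (k : ℝ) + 2 := by
    have := Nat.le_ceil (2 * τ)
    rw [hk] at this
    exact_mod_cast this
  have h2 : (k : ℝ) + 1 < 2 * τ := by
    have := Nat.ceil_lt_add_one (by linarith : 0 ≤ 2 * τ)
    rw [hk] at this
    push_cast at this
    linarith
  refine Set.mem_iUnion.2 ⟨k, hβ, ?_⟩
  simp only [Set.mem_preimage, Set.mem_Ioc, ← hτdef]
  constructor <;> linarith

theorem lintegral_heightStrip_le {x L : ℝ} (hx : 3 ≤ x) (k : ℕ) :
    ∫⁻ β in heightStrip (1 / x) k, ENNReal.ofReal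
        (‖(((1 / x : ℝ) : ℂ) + ((2 * β : ℝ) : ℂ) * Complex.I)⁻¹‖ ^ 2 *
          ‖puncturedTheta (((1 / x : ℝ) : ℂ) + ((2 * β : ℝ) : ℂ) * Complex.I)⁻¹‖ ^ 2 *
            windowWeight L β) ≤
      ENNReal.ofReal (10 ^ 10 * (x * Real.log x)) *
        ENNReal.ofReal (min (L ^ 2) (((k : ℝ) + 1) ^ 2) / ((k : ℝ) + 1) ^ 2) := by
  have hx0 : 0 < x := by linarith
  have hα : 0 < 1 / x := by positivity
  set α := 1 / x with hαdef
  have hk1 : (1 : ℝ) ≤ (k : ℝ) + 1 := by linarith [(k.cast_nonneg : (0 : ℝ) ≤ k)]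
  set κ : ℝ := (k : ℝ) + 1
  set ρ : ℝ := α * κ ^ 2 / 4 with hρdef
  have hρ : 0 < ρ := by positivity
  set m : ℝ := min (L ^ 2) (κ ^ 2)
  have hm : 0 ≤ m := by positivity
  have hcont : Continuous (inversionHeight α) :=
    continuous_iff_continuousAt.2 fun β => (hasDerivAt_inversionHeight hα β).continuousAt
  have hmeas : MeasurableSet (heightStrip α k) :=
    measurableSet_Icc.inter (hcont.measurable measurableSet_Ioc)
  have hcv := MeasureTheory.lintegral_image_eq_lintegral_abs_deriv_mul hmeas
    (fun β _ => (hasDerivAt_inversionHeight hα β).hasDerivWithinAt)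
    ((injOn_inversionHeight hα).mono fun β hβ => hβ.1.1)
    (fun τ => ENNReal.ofReal (2 * m) * ENNReal.ofReal (thetaMajorant ρ τ))
  calc _ ≤ ∫⁻ β in heightStrip α k,
          ENNReal.ofReal |(2 * α ^ 2 - 8 * β ^ 2) / (α ^ 2 + 4 * β ^ 2) ^ 2| *
            (ENNReal.ofReal (2 * m) *
              ENNReal.ofReal (thetaMajorant ρ (inversionHeight α β))) := by
        refine MeasureTheory.setLIntegral_mono' hmeas fun β hβ => ?_
        rw [← ENNReal.ofReal_mul (by positivity), ← ENNReal.ofReal_mul (abs_nonneg _)]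
        exact ENNReal.ofReal_le_ofReal
          (integrand_le_majorant hα hβ.1.1 hk1 hβ.2.1.le hβ.2.2)
    _ = ∫⁻ τ in inversionHeight α '' heightStrip α k,
          ENNReal.ofReal (2 * m) * ENNReal.ofReal (thetaMajorant ρ τ) := hcv.symm
    -- The image has length at most 1/2; it is enlarged to a full period so that Parseval applies.
    _ ≤ ∫⁻ τ in Set.Ioc (κ / 2) (κ / 2 + 2),
          ENNReal.ofReal (2 * m) * ENNReal.ofReal (thetaMajorant ρ τ) := by
        apply MeasureTheory.lintegral_mono_set
        rintro _ ⟨β, hβ, rfl⟩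
        exact ⟨hβ.2.1, hβ.2.2.trans (by linarith)⟩
    _ ≤ ENNReal.ofReal (2 * m) * (ENNReal.ofReal 260 *
          ENNReal.ofReal (320000 / (Real.pi * ρ) * Real.log (2 + 16 / (Real.pi * ρ)))) := by
        rw [MeasureTheory.lintegral_const_mul' _ _ ENNReal.ofReal_ne_top]
        gcongr
        refine (lintegral_thetaMajorant_le hρ _).trans ?_
        gcongr
        exact equalNormSum_le (by positivity)
    _ ≤ _ := by
        rw [← ENNReal.ofReal_mul (by positivity), ← ENNReal.ofReal_mul (by positivity),
          ← ENNReal.ofReal_mul (by have := Real.log_nonneg (by linarith : 1 ≤ x); positivity)]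
        apply ENNReal.ofReal_le_ofReal
        have hlog := log_two_add_le hx hk1
        have hl0 : 0 ≤ Real.log x := Real.log_nonneg (by linarith)
        have h1 : 320000 / (Real.pi * ρ) ≤ 320000 * (4 * x / κ ^ 2) / 3 := by
          rw [hρdef, hαdef]
          calc _ ≤ 320000 / (3 * (1 / x * κ ^ 2 / 4)) := by
                gcongr
                exact Real.pi_gt_three.le
            _ = _ := by field_simp
        have hlog0 : 0 ≤ Real.log (2 + 16 / (Real.pi * ρ)) := by
          have : 0 ≤ 16 / (Real.pi * ρ) := by positivity
          exact Real.log_nonneg (by linarith)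
        calc _ ≤ 2 * m * (260 * (320000 * (4 * x / κ ^ 2) / 3 * (5 * Real.log x))) := by
              gcongr
          _ = (2 * 260 * 320000 * 4 / 3 * 5) * (x * Real.log x) * (m / κ ^ 2) := by
              field_simp
          _ ≤ _ := by
              gcongr
              norm_num

theorem lintegral_Icc_theta_le {x L : ℝ} (hx : 3 ≤ x) (hL : 1 ≤ L) :
    ∫⁻ β in Set.Icc (1 / x) (1 / 2), ENNReal.ofReal
        (‖(((1 / x : ℝ) : ℂ) + ((2 * β : ℝ) : ℂ) * Complex.I)⁻¹‖ ^ 2 *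
          ‖puncturedTheta (((1 / x : ℝ) : ℂ) + ((2 * β : ℝ) : ℂ) * Complex.I)⁻¹‖ ^ 2 *
            windowWeight L β) ≤
      ENNReal.ofReal (4 * 10 ^ 10 * (x * Real.log x * L)) := by
  have hx0 : 0 < x := by linarith
  have hl0 : 0 ≤ Real.log x := Real.log_nonneg (by linarith)
  refine (MeasureTheory.lintegral_mono_set (Icc_subset_iUnion_heightStrip (by positivity)
    (one_div_le_one_div_of_le (by norm_num) hx))).trans ?_
  refine (MeasureTheory.lintegral_iUnion_le _ _).trans ?_
  refine (ENNReal.tsum_le_tsum fun k => lintegral_heightStrip_le hx k).trans ?_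
  rw [ENNReal.tsum_mul_left]
  refine (mul_le_mul_right (sum_le_of_le_mul_telescope hL) _).trans (le_of_eq ?_)
  rw [← ENNReal.ofReal_mul (by positivity)]
  congr 1
  ring

/-! ### Exponential sums over finite sets and windows. -/

/-- The exponential sum with frequencies in `J`. -/
noncomputable def expSum (J : Finset ℕ) (β : ℝ) : ℂ :=
  ∑ j ∈ J, Complex.exp ((2 * Real.pi * j * β : ℝ) * Complex.I)

theorem continuous_expSum (J : Finset ℕ) : Continuous (expSum J) := by
  unfold expSum
  fun_prop

theorem integral_norm_sq_expSum_le (J : Finset ℕ) :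
    ∫ β in (-(1 / 2 : ℝ))..(1 / 2), ‖expSum J β‖ ^ 2 ≤ 2 * J.card := by
  -- In the period-two normalization e(jβ) has frequency -2j; the period of length 2 accounts for
  -- the factor 2.
  have h := integral_norm_sq_tsum_exp (ι := J) (a := fun _ => 1) (fun _ => zero_le_one)
    (hasSum_fintype _).summable (fun j => -(2 * (j : ℕ) : ℤ)) (-(1 / 2))
  have e : ∀ β : ℝ, (∑' i : J, ((1 : ℝ) : ℂ) *
      Complex.exp ((-(Real.pi * ((-(2 * ((i : ℕ) : ℤ)) : ℤ) : ℝ) * β) : ℝ) * Complex.I)) =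
      expSum J β := by
    intro β
    rw [tsum_fintype, Finset.sum_coe_sort J (fun i : ℕ => ((1 : ℝ) : ℂ) *
      Complex.exp ((-(Real.pi * ((-(2 * (i : ℤ)) : ℤ) : ℝ) * β) : ℝ) * Complex.I))]
    unfold expSum
    refine Finset.sum_congr rfl fun j _ => ?_
    rw [Complex.ofReal_one, one_mul]
    congr 2
    push_cast
    ring
  simp_rw [e] at h
  have hc : Continuous fun β => ‖expSum J β‖ ^ 2 := (continuous_expSum J).norm.pow 2
  calc _ ≤ ∫ β in (-(1 / 2 : ℝ))..(-(1 / 2) + 2), ‖expSum J β‖ ^ 2 :=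
        intervalIntegral.integral_mono_interval le_rfl (by norm_num) (by norm_num)
          (Filter.Eventually.of_forall fun x => sq_nonneg _) (hc.intervalIntegrable _ _)
    _ = _ := by
        rw [h, tsum_fintype, Fintype.sum_prod_type]
        simp [mul_comm]

theorem norm_expSum_range_le (L : ℕ) (β : ℝ) : ‖expSum (Finset.range L) β‖ ≤ L := by
  unfold expSum
  refine (norm_sum_le _ _).trans ?_
  simp_rw [Complex.norm_exp_ofReal_mul_I]
  simp

/-- A geometric sum with ratio r = e(β): |r^L - 1| ≤ 2, and |r - 1| = 2|sin πβ| ≥ 4|β| by Jordan's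
inequality. -/
theorem norm_expSum_range_mul_le (L : ℕ) {β : ℝ} (hβ : |β| ≤ 1 / 2) :
    ‖expSum (Finset.range L) β‖ * (2 * |β|) ≤ 1 := by
  set r : ℂ := Complex.exp ((2 * Real.pi * β : ℝ) * Complex.I) with hr
  have h1 : expSum (Finset.range L) β = ∑ h ∈ Finset.range L, r ^ h := by
    unfold expSum
    refine Finset.sum_congr rfl fun h _ => ?_
    rw [hr, ← Complex.exp_nat_mul]
    congr 1
    push_cast
    ring
  have h2 := geom_sum_mul r L
  rw [← h1] at h2
  have h3 : ‖r ^ L - 1‖ ≤ 2 := by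
    refine (norm_sub_le _ _).trans ?_
    rw [norm_pow, hr, Complex.norm_exp_ofReal_mul_I]
    norm_num
  have h4 : 4 * |β| ≤ ‖r - 1‖ := by
    rw [hr, mul_comm (Complex.ofReal _) Complex.I, Complex.norm_exp_I_mul_ofReal_sub_one, norm_mul]
    have hx : |Real.pi * β| ≤ Real.pi / 2 := by
      rw [abs_mul, abs_of_pos Real.pi_pos]
      nlinarith [Real.pi_pos]
    have h5 := Real.mul_abs_le_abs_sin hx
    rw [abs_mul, abs_of_pos Real.pi_pos] at h5
    have h6 : 2 / Real.pi * (Real.pi * |β|) = 2 * |β| := by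
      have := Real.pi_ne_zero
      field_simp
    rw [h6] at h5
    rw [show 2 * Real.pi * β / 2 = Real.pi * β by ring, Real.norm_eq_abs, Real.norm_eq_abs]
    norm_num
    linarith
  have h7 : ‖expSum (Finset.range L) β‖ * ‖r - 1‖ ≤ 2 := by
    rw [← norm_mul, h2]
    exact h3
  nlinarith [norm_nonneg (expSum (Finset.range L) β)]

theorem norm_sq_expSum_range_le (L : ℕ) {β : ℝ} (hβ : |β| ≤ 1 / 2) (h0 : β ≠ 0) :
    ‖expSum (Finset.range L) β‖ ^ 2 ≤ windowWeight L β := by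
  have h1 := norm_expSum_range_mul_le L hβ
  refine le_min (pow_le_pow_left₀ (norm_nonneg _) (norm_expSum_range_le L β) 2) ?_
  rw [le_div_iff₀ (by positivity)]
  have h2 := pow_le_one₀ (n := 2) (by positivity) h1
  rw [mul_pow, mul_pow, sq_abs] at h2
  linarith

theorem integral_tsum_exp_mul_expSum {ι : Type*} [Countable ι] {a : ι → ℝ}
    (ha : ∀ i, 0 ≤ a i) (hs : Summable a) (f : ι → ℤ) (J K : Finset ℕ) :
    ∫ β in (-(1 / 2 : ℝ))..(1 / 2), (∑' i, (a i : ℂ) * Complex.exp ((-(2 * Real.pi * f i * β) : ℝ) *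
        Complex.I)) * (expSum J β * expSum K β) =
      ((∑ j ∈ J, ∑ h ∈ K, ∑' i, if f i = (j + h : ℕ) then a i else 0 : ℝ) : ℂ) := by
  have hc := continuous_tsum_exp ha hs f (2 * Real.pi)
  have e : ∀ β : ℝ, (∑' i, (a i : ℂ) * Complex.exp ((-(2 * Real.pi * f i * β) : ℝ) *
        Complex.I)) * (expSum J β * expSum K β) = ∑ j ∈ J, ∑ h ∈ K,
        (∑' i, (a i : ℂ) * Complex.exp ((-(2 * Real.pi * f i * β) : ℝ) * Complex.I)) *
          Complex.exp ((2 * Real.pi * ((j + h : ℕ) : ℤ) * β : ℝ) * Complex.I) := by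
    intro β
    unfold expSum
    rw [Finset.sum_mul_sum, Finset.mul_sum]
    refine Finset.sum_congr rfl fun j _ => ?_
    rw [Finset.mul_sum]
    refine Finset.sum_congr rfl fun h _ => ?_
    rw [← Complex.exp_add]
    congr 2
    push_cast
    ring
  simp_rw [e]
  have hci : ∀ n : ℤ, IntervalIntegrable (fun β : ℝ =>
      (∑' i, (a i : ℂ) * Complex.exp ((-(2 * Real.pi * f i * β) : ℝ) * Complex.I)) *
          Complex.exp ((2 * Real.pi * n * β : ℝ) * Complex.I)) MeasureTheory.volume
          (-(1 / 2)) (1 / 2) := fun n =>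
    (hc.mul (by fun_prop)).intervalIntegrable _ _
  have hcj : ∀ j ∈ J, IntervalIntegrable (fun β : ℝ => ∑ h ∈ K,
      (∑' i, (a i : ℂ) * Complex.exp ((-(2 * Real.pi * f i * β) : ℝ) * Complex.I)) *
          Complex.exp ((2 * Real.pi * ((j + h : ℕ) : ℤ) * β : ℝ) * Complex.I))
      MeasureTheory.volume (-(1 / 2)) (1 / 2) := fun j _ =>
    (continuous_finsetSum K fun h _ => hc.mul (by fun_prop)).intervalIntegrable _ _
  rw [intervalIntegral.integral_finsetSum hcj]
  rw [Complex.ofReal_sum]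
  refine Finset.sum_congr rfl fun j _ => ?_
  rw [intervalIntegral.integral_finsetSum fun h _ => hci _, Complex.ofReal_sum]
  exact Finset.sum_congr rfl fun h _ => integral_tsum_exp_mul_exp ha hs f _

/-! ### Main term minus theta series. -/

/-- With u = a + bi, |e^u - 1|² = (e^a - 1)² + 2e^a(1 - cos b), where e^a - 1 ≥ a and 1 - cos b ≥
2b²/π². -/
theorem half_norm_le_norm_exp_sub_one {u : ℂ} (h0 : 0 ≤ u.re) (h1 : |u.im| ≤ Real.pi) :
    ‖u‖ / 2 ≤ ‖Complex.exp u - 1‖ := by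
  have hcos := Real.cos_le_one_sub_mul_cos_sq h1
  have hexp := Real.add_one_le_exp u.re
  have hpi := Real.pi_lt_four
  have hpi0 := Real.pi_pos
  have h2 : ‖Complex.exp u - 1‖ ^ 2 =
      (Real.exp u.re - 1) ^ 2 + 2 * Real.exp u.re * (1 - Real.cos u.im) := by
    rw [← Complex.normSq_eq_norm_sq, Complex.normSq_apply]
    simp only [Complex.sub_re, Complex.sub_im, Complex.exp_re, Complex.exp_im, Complex.one_re,
      Complex.one_im]
    linear_combination (Real.exp u.re) ^ 2 * Real.sin_sq_add_cos_sq u.im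
  have h3 : ‖u‖ ^ 2 = u.re ^ 2 + u.im ^ 2 := by
    rw [← Complex.normSq_eq_norm_sq, Complex.normSq_apply]
    ring
  have h4 : 1 / 8 * u.im ^ 2 ≤ 2 / Real.pi ^ 2 * u.im ^ 2 := by
    apply mul_le_mul_of_nonneg_right _ (sq_nonneg _)
    rw [div_le_div_iff₀ (by norm_num) (by positivity)]
    nlinarith
  have h5 : (‖u‖ / 2) ^ 2 ≤ ‖Complex.exp u - 1‖ ^ 2 := by
    rw [div_pow, h2, h3]
    have h6 : u.re ^ 2 ≤ (Real.exp u.re - 1) ^ 2 := pow_le_pow_left₀ h0 (by linarith) 2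
    have h7 : 1 * (1 / 8 * u.im ^ 2) ≤ Real.exp u.re * (1 - Real.cos u.im) :=
      mul_le_mul (by linarith) (by linarith) (by positivity) (Real.exp_pos _).le
    nlinarith [sq_nonneg u.re]
  exact le_of_sq_le_sq h5 (norm_nonneg _)

/-- The simple poles at 0 cancel, which handles |u| ≤ 1; for |u| > 1 the two terms are bounded
separately. -/
theorem norm_inv_exp_sub_one_sub_inv_le {u : ℂ} (h0 : 0 < u.re) (h1 : |u.im| ≤ Real.pi) :
    ‖(Complex.exp u - 1)⁻¹ - u⁻¹‖ ≤ 3 := by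
  have h := half_norm_le_norm_exp_sub_one h0.le h1
  have hu : u ≠ 0 := by
    rintro rfl
    simp at h0
  have hun : 0 < ‖u‖ := norm_pos_iff.2 hu
  have hen : 0 < ‖Complex.exp u - 1‖ := by linarith
  rcases le_or_gt ‖u‖ 1 with hle | hgt
  · rw [inv_sub_inv (norm_pos_iff.1 hen) hu, norm_div, norm_mul, div_le_iff₀ (by positivity)]
    have h2 := Complex.norm_exp_sub_one_sub_id_le hle
    rw [norm_sub_rev] at h2
    nlinarith
  · refine (norm_sub_le _ _).trans ?_
    rw [norm_inv, norm_inv]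
    have h2 : ‖u‖⁻¹ ≤ 1 := inv_le_one_of_one_le₀ hgt.le
    have h3 : ‖Complex.exp u - 1‖⁻¹ ≤ 2 := by
      rw [inv_le_comm₀ hen (by norm_num)]
      linarith
    linarith

/-- The coefficients of the main term: `π exp (-π α (n + 1))`. -/
noncomputable def mainCoeff (α : ℝ) (n : ℕ) : ℝ := Real.pi * Real.exp (-(Real.pi * α * (n + 1)))

theorem mainCoeff_nonneg (α : ℝ) (n : ℕ) : 0 ≤ mainCoeff α n := by
  unfold mainCoeff
  positivity

theorem summable_mainCoeff {α : ℝ} (hα : 0 < α) : Summable (mainCoeff α) := by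
  have hpi := Real.pi_pos
  have h1 : Summable fun n : ℕ => Real.exp (-(Real.pi * α)) ^ (n + 1) :=
    (summable_nat_add_iff 1).2 (summable_geometric_of_lt_one (Real.exp_pos _).le
      (Real.exp_lt_one_iff.2 (by nlinarith)))
  refine (h1.mul_left Real.pi).congr fun n => ?_
  rw [← Real.exp_nat_mul, mainCoeff]
  congr 2
  push_cast
  ring

theorem tsum_mainCoeff {α : ℝ} (hα : 0 < α) (β : ℝ) :
    ∑' n : ℕ, (mainCoeff α n : ℂ) *
        Complex.exp ((-(2 * Real.pi * ((n + 1 : ℕ) : ℤ) * β) : ℝ) * Complex.I) =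
      Real.pi * (Complex.exp (Real.pi * ((α : ℂ) + ((2 * β : ℝ) : ℂ) * Complex.I)) - 1)⁻¹ := by
  set w : ℂ := (α : ℂ) + ((2 * β : ℝ) : ℂ) * Complex.I with hw
  have hre : w.re = α := by simp [hw]
  set q : ℂ := Complex.exp (-(Real.pi * w)) with hq
  have hq1 : ‖q‖ < 1 := by
    rw [hq, Complex.norm_exp, Real.exp_lt_one_iff]
    have : (-(Real.pi * w)).re = -(Real.pi * α) := by simp [hre]
    rw [this]
    have := Real.pi_pos
    nlinarith
  have hg := (hasSum_geometric_of_norm_lt_one hq1).mul_left (Real.pi * q)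
  have e : ∀ n : ℕ, (mainCoeff α n : ℂ) *
        Complex.exp ((-(2 * Real.pi * ((n + 1 : ℕ) : ℤ) * β) : ℝ) * Complex.I) =
        Real.pi * q * q ^ n := by
    intro n
    rw [mul_assoc (Real.pi : ℂ) q, ← pow_succ', hq, ← Complex.exp_nat_mul, mainCoeff, Complex.ofReal_mul,
      Complex.ofReal_exp, mul_assoc, ← Complex.exp_add]
    congr 2
    rw [hw]
    push_cast
    ring
  simp_rw [e]
  rw [hg.tsum_eq, mul_assoc]
  congr 1
  have hE : Complex.exp (Real.pi * w) = q⁻¹ := by rw [hq, Complex.exp_neg, inv_inv]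
  have hq0 : q ≠ 0 := Complex.exp_ne_zero _
  have hq2 : 1 - q ≠ 0 := by
    intro h
    rw [← sub_eq_zero.1 h] at hq1
    simp at hq1
  rw [hE, show q⁻¹ - 1 = (1 - q) / q by field_simp, inv_div, div_eq_mul_inv]

theorem latticeTheta_mk (α β : ℝ) :
    latticeTheta ((α : ℂ) + ((2 * β : ℝ) : ℂ) * Complex.I) =
      ∑' v : ℤ × ℤ, ((Real.exp (-(Real.pi * α * (latticeNorm v : ℝ))) : ℝ) : ℂ) *
        Complex.exp ((-(2 * Real.pi * latticeNorm v * β) : ℝ) * Complex.I) := by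
  unfold latticeTheta
  congr 1 with v
  rw [Complex.ofReal_exp, ← Complex.exp_add]
  congr 1
  push_cast
  ring

/-- The main term minus the theta series, on the line `re w = α`. -/
noncomputable def thetaError (α β : ℝ) : ℂ :=
  Real.pi * (Complex.exp (Real.pi * ((α : ℂ) + ((2 * β : ℝ) : ℂ) * Complex.I)) - 1)⁻¹ -
    latticeTheta ((α : ℂ) + ((2 * β : ℝ) : ℂ) * Complex.I)

theorem thetaError_eq {α : ℝ} (hα : 0 < α) (β : ℝ) :
    thetaError α β = (∑' n : ℕ, (mainCoeff α n : ℂ) *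
        Complex.exp ((-(2 * Real.pi * ((n + 1 : ℕ) : ℤ) * β) : ℝ) * Complex.I)) -
      ∑' v : ℤ × ℤ, ((Real.exp (-(Real.pi * α * (latticeNorm v : ℝ))) : ℝ) : ℂ) *
        Complex.exp ((-(2 * Real.pi * latticeNorm v * β) : ℝ) * Complex.I) := by
  rw [thetaError, tsum_mainCoeff hα, latticeTheta_mk]

theorem continuous_thetaError {α : ℝ} (hα : 0 < α) : Continuous (thetaError α) := by
  have h1 := continuous_tsum_exp (mainCoeff_nonneg α) (summable_mainCoeff hα)
    (fun n : ℕ => ((n + 1 : ℕ) : ℤ)) (2 * Real.pi)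
  have h2 := continuous_tsum_exp (fun v : ℤ × ℤ =>
    (Real.exp_pos (-(Real.pi * α * (latticeNorm v : ℝ)))).le)
    (summable_lattice_exp (by positivity)) latticeNorm (2 * Real.pi)
  rw [funext (thetaError_eq hα)]
  exact h1.sub h2

/-- The integral extracts the coefficients of E at the frequencies j + h. The gap hypothesis makes
those of the theta series vanish; j ≥ 1 ensures that j + h occurs in the main term, which starts at
frequency 1. -/
theorem integral_thetaError_mul_expSum {α : ℝ} (hα : 0 < α) {J K : Finset ℕ}
    (hJ : ∀ j ∈ J, 1 ≤ j) (hJK : ∀ j ∈ J, ∀ h ∈ K, ∀ v, latticeNorm v ≠ (j + h : ℕ)) :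
    ∫ β in (-(1 / 2 : ℝ))..(1 / 2), thetaError α β * (expSum J β * expSum K β) =
      ((∑ j ∈ J, ∑ h ∈ K, Real.pi * Real.exp (-(Real.pi * α * (j + h))) : ℝ) : ℂ) := by
  have hs : Summable fun v : ℤ × ℤ => Real.exp (-(Real.pi * α * (latticeNorm v : ℝ))) :=
    summable_lattice_exp (by positivity)
  have hp : ∀ v : ℤ × ℤ, 0 ≤ Real.exp (-(Real.pi * α * (latticeNorm v : ℝ))) :=
    fun v => (Real.exp_pos _).le
  have hT : Continuous fun β => expSum J β * expSum K β :=
    (continuous_expSum J).mul (continuous_expSum K)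
  have hi1 : IntervalIntegrable (fun β : ℝ => (∑' n : ℕ, (mainCoeff α n : ℂ) *
        Complex.exp ((-(2 * Real.pi * ((n + 1 : ℕ) : ℤ) * β) : ℝ) * Complex.I)) *
          (expSum J β * expSum K β)) MeasureTheory.volume (-(1 / 2)) (1 / 2) :=
    ((continuous_tsum_exp (mainCoeff_nonneg α) (summable_mainCoeff hα)
      (fun n : ℕ => ((n + 1 : ℕ) : ℤ)) (2 * Real.pi)).mul hT).intervalIntegrable _ _
  have hi2 : IntervalIntegrable (fun β : ℝ => (∑' v : ℤ × ℤ,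
        ((Real.exp (-(Real.pi * α * (latticeNorm v : ℝ))) : ℝ) : ℂ) *
        Complex.exp ((-(2 * Real.pi * latticeNorm v * β) : ℝ) * Complex.I)) *
          (expSum J β * expSum K β)) MeasureTheory.volume (-(1 / 2)) (1 / 2) :=
    ((continuous_tsum_exp hp hs latticeNorm (2 * Real.pi)).mul hT).intervalIntegrable _ _
  simp_rw [thetaError_eq hα, sub_mul]
  rw [intervalIntegral.integral_sub hi1 hi2,
    integral_tsum_exp_mul_expSum (mainCoeff_nonneg α) (summable_mainCoeff hα)
      (fun n : ℕ => ((n + 1 : ℕ) : ℤ)), integral_tsum_exp_mul_expSum hp hs latticeNorm,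
    ← Complex.ofReal_sub, ← Finset.sum_sub_distrib]
  congr 1
  refine Finset.sum_congr rfl fun j hj => ?_
  rw [← Finset.sum_sub_distrib]
  refine Finset.sum_congr rfl fun h hh => ?_
  have h1 : ∀ v : ℤ × ℤ, (if latticeNorm v = (j + h : ℕ) then
      Real.exp (-(Real.pi * α * (latticeNorm v : ℝ))) else 0) = 0 :=
    fun v => if_neg (hJK j hj h hh v)
  simp_rw [h1]
  rw [tsum_zero, sub_zero]
  obtain ⟨i, rfl⟩ : ∃ i, j = i + 1 := ⟨j - 1, by have := hJ j hj; omega⟩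
  rw [tsum_eq_single (i + h)]
  · rw [if_pos (by push_cast; ring), mainCoeff]
    push_cast
    congr 2
    ring
  · intro n hn
    rw [if_neg]
    intro hc
    apply hn
    have : n + 1 = i + 1 + h := by exact_mod_cast hc
    omega

/-- Both the main term and the inverted theta series contain w⁻¹, which cancels. What is left of the
main term is at most 3π < 10, and (10+q)² ≤ 200 + 2q². -/
theorem norm_sq_thetaError_le {α β : ℝ} (hα : 0 < α) (hβ : |β| ≤ 1 / 2) :
    ‖thetaError α β‖ ^ 2 ≤ 300 + 2 * (‖((α : ℂ) + ((2 * β : ℝ) : ℂ) * Complex.I)⁻¹‖ ^ 2 *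
      ‖puncturedTheta ((α : ℂ) + ((2 * β : ℝ) : ℂ) * Complex.I)⁻¹‖ ^ 2) := by
  unfold thetaError
  set w : ℂ := (α : ℂ) + ((2 * β : ℝ) : ℂ) * Complex.I with hw
  have hre : w.re = α := by simp [hw]
  have him : w.im = 2 * β := by simp [hw]
  have hpi : (Real.pi : ℂ) ≠ 0 := by exact_mod_cast Real.pi_ne_zero
  have hpi0 := Real.pi_pos
  have hpi4 := Real.pi_lt_four
  have hpi' := Real.pi_lt_d2
  have h1 := norm_inv_exp_sub_one_sub_inv_le (u := Real.pi * w)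
    (by simp [hre, hα, Real.pi_pos])
    (by
      have : (Real.pi * w).im = Real.pi * (2 * β) := by simp [him]
      rw [this, abs_mul, abs_mul, abs_of_pos Real.pi_pos, abs_two]
      nlinarith)
  rw [latticeTheta_eq_inv_add (by rw [hre]; exact hα)]
  set E := (Complex.exp (Real.pi * w) - 1)⁻¹
  set Q := w⁻¹ * puncturedTheta w⁻¹ with hQ
  have h2 : ‖(Real.pi : ℂ) * E - (w⁻¹ + Q)‖ ≤ 10 + ‖Q‖ := by
    have e : (Real.pi : ℂ) * E - (w⁻¹ + Q) = Real.pi * (E - (Real.pi * w)⁻¹) - Q := by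
      rw [mul_inv, mul_sub, mul_inv_cancel_left₀ hpi]
      ring
    rw [e]
    refine (norm_sub_le _ _).trans (add_le_add_left ?_ _)
    rw [norm_mul, Complex.norm_real, Real.norm_eq_abs, abs_of_pos Real.pi_pos]
    nlinarith [norm_nonneg (E - (Real.pi * w)⁻¹)]
  rw [← mul_pow, ← norm_mul, ← hQ]
  have h3 := pow_le_pow_left₀ (norm_nonneg _) h2 2
  nlinarith [sq_nonneg (10 - ‖Q‖)]

/-! ### Mean square of the error against a window. -/

/-- The squared modulus of the non-constant part of the inverted theta series. -/
noncomputable def thetaEnergy (α β : ℝ) : ℝ :=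
  ‖((α : ℂ) + ((2 * β : ℝ) : ℂ) * Complex.I)⁻¹‖ ^ 2 *
    ‖puncturedTheta ((α : ℂ) + ((2 * β : ℝ) : ℂ) * Complex.I)⁻¹‖ ^ 2

theorem thetaEnergy_nonneg (α β : ℝ) : 0 ≤ thetaEnergy α β :=
  mul_nonneg (sq_nonneg _) (sq_nonneg _)

theorem thetaEnergy_neg (α β : ℝ) : thetaEnergy α (-β) = thetaEnergy α β := by
  have h : (α : ℂ) + ((2 * -β : ℝ) : ℂ) * Complex.I =
      (starRingEnd ℂ) ((α : ℂ) + ((2 * β : ℝ) : ℂ) * Complex.I) := by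
    simp only [map_add, map_mul, Complex.conj_ofReal, Complex.conj_I]
    push_cast
    ring
  unfold thetaEnergy
  rw [h, ← map_inv₀, puncturedTheta_conj, RCLike.norm_conj, RCLike.norm_conj]

/-- Near β = 0 the real part of w⁻¹ is at least 1/(5α), so ψ(w⁻¹) = O(α), which offsets |w|⁻² ≤ α⁻².
-/
theorem thetaEnergy_le {α β : ℝ} (hα : 0 < α) (hβ : |β| ≤ α) : thetaEnergy α β ≤ 20000 := by
  unfold thetaEnergy
  rw [norm_sq_inv_mk, norm_puncturedTheta_inv_mk]
  have hβ2 : β ^ 2 ≤ α ^ 2 := sq_le_sq' (abs_le.1 hβ).1 (abs_le.1 hβ).2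
  set D := α ^ 2 + 4 * β ^ 2 with hD
  have hD0 : 0 < D := by positivity
  have hre : ((((α / D : ℝ) : ℂ) + (inversionHeight α β : ℝ) * Complex.I)).re = α / D := by simp
  have hP := norm_puncturedTheta_le
    (z := (((α / D : ℝ) : ℂ) + (inversionHeight α β : ℝ) * Complex.I)) (by rw [hre]; positivity)
  rw [hre] at hP
  have h1 : 80 / (Real.pi * (α / D)) * Real.exp (-(Real.pi * (α / D) / 4)) ≤ 140 * α := by
    have h2 : Real.exp (-(Real.pi * (α / D) / 4)) ≤ 1 :=
      Real.exp_le_one_iff.2 (neg_nonpos.2 (by positivity))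
    have h3 : 80 / (Real.pi * (α / D)) ≤ 140 * α := by
      rw [div_le_iff₀ (by positivity)]
      have h4 : 1 / 5 ≤ α * (α / D) := by
        rw [← mul_div_assoc, div_le_div_iff₀ (by norm_num) hD0]
        rw [hD]
        nlinarith
      nlinarith [Real.pi_gt_three]
    calc _ ≤ 80 / (Real.pi * (α / D)) * 1 := mul_le_mul_of_nonneg_left h2 (by positivity)
      _ ≤ _ := by linarith
  have h5 := pow_le_pow_left₀ (norm_nonneg _) (hP.trans h1) 2
  have h6 : 1 / D ≤ 1 / α ^ 2 :=
    one_div_le_one_div_of_le (by positivity) (by rw [hD]; nlinarith [sq_nonneg β])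
  calc _ ≤ 1 / α ^ 2 * (140 * α) ^ 2 := mul_le_mul h6 h5 (sq_nonneg _) (by positivity)
    _ = 140 ^ 2 := by field_simp
    _ ≤ _ := by norm_num

theorem norm_expSum_neg (J : Finset ℕ) (β : ℝ) : ‖expSum J (-β)‖ = ‖expSum J β‖ := by
  have h : expSum J (-β) = (starRingEnd ℂ) (expSum J β) := by
    unfold expSum
    rw [map_sum]
    refine Finset.sum_congr rfl fun j _ => ?_
    rw [← Complex.exp_conj, map_mul, Complex.conj_ofReal, Complex.conj_I]
    congr 1
    push_cast
    ring
  rw [h, RCLike.norm_conj]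

theorem lintegral_thetaEnergy_expSum_outer_le {x : ℝ} (hx : 3 ≤ x) {L : ℕ} (hL : 1 ≤ L) :
    ∫⁻ β in Set.Icc (1 / x) (1 / 2), ENNReal.ofReal
        (thetaEnergy (1 / x) β * ‖expSum (Finset.range L) β‖ ^ 2) ≤
      ENNReal.ofReal (4 * 10 ^ 10 * (x * Real.log x * L)) := by
  have hx0 : 0 < x := by linarith
  have hα : 0 < 1 / x := by positivity
  refine le_trans (MeasureTheory.setLIntegral_mono' measurableSet_Icc fun β hβ => ?_)
    (lintegral_Icc_theta_le hx (L := L) (by exact_mod_cast hL))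
  have hβ0 : 0 < β := hα.trans_le hβ.1
  exact ENNReal.ofReal_le_ofReal (mul_le_mul_of_nonneg_left
    (norm_sq_expSum_range_le L (by rw [abs_of_pos hβ0]; exact hβ.2) hβ0.ne')
    (thetaEnergy_nonneg _ _))

theorem lintegral_Icc_neg (f : ℝ → ENNReal) (hf : ∀ β, f (-β) = f β) (a b : ℝ) :
    ∫⁻ β in Set.Icc (-b) (-a), f β = ∫⁻ β in Set.Icc a b, f β := by
  have h := (MeasureTheory.Measure.measurePreserving_neg
    (MeasureTheory.volume : MeasureTheory.Measure ℝ)).setLIntegral_comp_preimage_emb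
    (Homeomorph.neg ℝ).measurableEmbedding f (Set.Icc a b)
  rw [← h]
  simp [hf]

/-- The two outer ranges agree by evenness in β. The central range |β| ≤ 1/x contributes O(L²/x),
which is O(L) because L ≤ x. -/
theorem lintegral_thetaEnergy_expSum_le {x : ℝ} (hx : 3 ≤ x) {L : ℕ} (hL : 1 ≤ L)
    (hLx : (L : ℝ) ≤ x) :
    ∫⁻ β in Set.Ioc (-(1 / 2)) (1 / 2), ENNReal.ofReal
        (thetaEnergy (1 / x) β * ‖expSum (Finset.range L) β‖ ^ 2) ≤
      ENNReal.ofReal (10 ^ 11 * (x * Real.log x * L)) := by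
  have hx0 : 0 < x := by linarith
  have hα : 0 < 1 / x := by positivity
  set f : ℝ → ENNReal := fun β => ENNReal.ofReal
        (thetaEnergy (1 / x) β * ‖expSum (Finset.range L) β‖ ^ 2) with hf
  have hneg : ∀ β, f (-β) = f β := fun β => by
    simp only [hf, thetaEnergy_neg, norm_expSum_neg]
  have hout := lintegral_thetaEnergy_expSum_outer_le hx hL
  have hlog : 1 ≤ Real.log x := by
    rw [Real.le_log_iff_exp_le hx0]
    linarith [Real.exp_one_lt_d9]
  have hmid : ∫⁻ β in Set.Icc (-(1 / x)) (1 / x), f β ≤ ENNReal.ofReal (40000 * L) := by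
    calc _ ≤ ∫⁻ β in Set.Icc (-(1 / x)) (1 / x), ENNReal.ofReal (20000 * (L : ℝ) ^ 2) := by
          refine MeasureTheory.setLIntegral_mono' measurableSet_Icc fun β hβ => ?_
          exact ENNReal.ofReal_le_ofReal (mul_le_mul (thetaEnergy_le hα (abs_le.2 hβ))
            (pow_le_pow_left₀ (norm_nonneg _) (norm_expSum_range_le L β) 2) (sq_nonneg _)
            (by norm_num))
      _ = ENNReal.ofReal (20000 * (L : ℝ) ^ 2 * (2 / x)) := by
          rw [MeasureTheory.setLIntegral_const, Real.volume_Icc,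
            ← ENNReal.ofReal_mul (by positivity)]
          congr 2
          ring
      _ ≤ _ := by
          apply ENNReal.ofReal_le_ofReal
          have h1 : (L : ℝ) / x ≤ 1 := (div_le_one hx0).2 hLx
          calc 20000 * (L : ℝ) ^ 2 * (2 / x) = 40000 * L * (L / x) := by ring
            _ ≤ 40000 * L * 1 := by gcongr
            _ = _ := mul_one _
  have hsub : Set.Ioc (-(1 / 2 : ℝ)) (1 / 2) ⊆
      (Set.Icc (-(1 / 2)) (-(1 / x)) ∪ Set.Icc (-(1 / x)) (1 / x)) ∪ Set.Icc (1 / x) (1 / 2) := by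
    intro β hβ
    rcases le_total β (-(1 / x)) with h | h
    · exact Or.inl (Or.inl ⟨hβ.1.le, h⟩)
    · rcases le_total β (1 / x) with h' | h'
      · exact Or.inl (Or.inr ⟨h, h'⟩)
      · exact Or.inr ⟨h', hβ.2⟩
  calc _ ≤ _ := MeasureTheory.lintegral_mono_set hsub
    _ ≤ _ := MeasureTheory.lintegral_union_le _ _ _
    _ ≤ _ := add_le_add_left (MeasureTheory.lintegral_union_le _ _ _) _
    _ ≤ ENNReal.ofReal (4 * 10 ^ 10 * (x * Real.log x * L)) + ENNReal.ofReal (40000 * L) +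
        ENNReal.ofReal (4 * 10 ^ 10 * (x * Real.log x * L)) := by
        rw [lintegral_Icc_neg f hneg]
        exact add_le_add (add_le_add hout hmid) hout
    _ = ENNReal.ofReal (4 * 10 ^ 10 * (x * Real.log x * L) + 40000 * L +
        4 * 10 ^ 10 * (x * Real.log x * L)) := by
        rw [ENNReal.ofReal_add (by positivity) (by positivity),
          ENNReal.ofReal_add (by positivity) (by positivity)]
    _ ≤ _ := by
        apply ENNReal.ofReal_le_ofReal
        have h1 : (L : ℝ) ≤ x * Real.log x * L := by
          have : 1 ≤ x * Real.log x := by nlinarith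
          nlinarith [(L.cast_nonneg : (0 : ℝ) ≤ L)]
        linarith

theorem integral_thetaError_expSum_le {x : ℝ} (hx : 3 ≤ x) {L : ℕ} (hL : 1 ≤ L)
    (hLx : (L : ℝ) ≤ x) :
    ∫ β in (-(1 / 2 : ℝ))..(1 / 2),
        ‖thetaError (1 / x) β * expSum (Finset.range L) β‖ ^ 2 ≤
      3 * 10 ^ 11 * (x * Real.log x * L) := by
  have hx0 : 0 < x := by linarith
  have hα : 0 < 1 / x := by positivity
  have hlog : 1 ≤ Real.log x := by
    rw [Real.le_log_iff_exp_le hx0]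
    linarith [Real.exp_one_lt_d9]
  have hcD := continuous_expSum (Finset.range L)
  have hc : Continuous fun β => ‖thetaError (1 / x) β * expSum (Finset.range L) β‖ ^ 2 :=
    ((continuous_thetaError hα).mul hcD).norm.pow 2
  have hcD2 : Continuous fun β => 300 * ‖expSum (Finset.range L) β‖ ^ 2 :=
    (hcD.norm.pow 2).const_mul 300
  have hD : ∫⁻ β in Set.Ioc (-(1 / 2 : ℝ)) (1 / 2),
      ENNReal.ofReal (300 * ‖expSum (Finset.range L) β‖ ^ 2) ≤ ENNReal.ofReal (600 * L) := by
    rw [← MeasureTheory.ofReal_integral_eq_lintegral_ofReal hcD2.integrableOn_Ioc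
      (Filter.Eventually.of_forall fun β => by positivity),
      ← intervalIntegral.integral_of_le (by norm_num), intervalIntegral.integral_const_mul]
    apply ENNReal.ofReal_le_ofReal
    have := integral_norm_sq_expSum_le (Finset.range L)
    rw [Finset.card_range] at this
    linarith
  rw [← ENNReal.ofReal_le_ofReal_iff (by positivity),
    intervalIntegral.integral_of_le (by norm_num),
    MeasureTheory.ofReal_integral_eq_lintegral_ofReal hc.integrableOn_Ioc
      (Filter.Eventually.of_forall fun β => sq_nonneg _)]
  calc _ ≤ ∫⁻ β in Set.Ioc (-(1 / 2 : ℝ)) (1 / 2),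
          (ENNReal.ofReal (300 * ‖expSum (Finset.range L) β‖ ^ 2) + ENNReal.ofReal 2 *
            ENNReal.ofReal (thetaEnergy (1 / x) β * ‖expSum (Finset.range L) β‖ ^ 2)) := by
        refine MeasureTheory.setLIntegral_mono' measurableSet_Ioc fun β hβ => ?_
        have hE := norm_sq_thetaError_le hα (abs_le.2 ⟨hβ.1.le, hβ.2⟩)
        have h0 := thetaEnergy_nonneg (1 / x) β
        rw [← ENNReal.ofReal_mul (by norm_num),
          ← ENNReal.ofReal_add (by positivity) (by positivity)]
        apply ENNReal.ofReal_le_ofReal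
        rw [norm_mul, mul_pow]
        calc _ ≤ (300 + 2 * thetaEnergy (1 / x) β) * ‖expSum (Finset.range L) β‖ ^ 2 :=
              mul_le_mul_of_nonneg_right hE (sq_nonneg _)
          _ = _ := by ring
    _ ≤ ENNReal.ofReal (600 * L) +
          ENNReal.ofReal 2 * ENNReal.ofReal (10 ^ 11 * (x * Real.log x * L)) := by
        rw [MeasureTheory.lintegral_add_left
          hcD2.measurable.ennreal_ofReal,
          MeasureTheory.lintegral_const_mul' _ _ ENNReal.ofReal_ne_top]
        exact add_le_add hD (mul_le_mul_right (lintegral_thetaEnergy_expSum_le hx hL hLx) _)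
    _ = ENNReal.ofReal (600 * L + 2 * (10 ^ 11 * (x * Real.log x * L))) := by
        rw [← ENNReal.ofReal_mul (by norm_num), ENNReal.ofReal_add (by positivity) (by positivity)]
    _ ≤ _ := by
        apply ENNReal.ofReal_le_ofReal
        have h1 : (L : ℝ) ≤ x * Real.log x * L := by
          have : 1 ≤ x * Real.log x := by nlinarith
          nlinarith [(L.cast_nonneg : (0 : ℝ) ≤ L)]
        linarith

/-! ### Counting the starting points of gaps. -/

theorem norm_integral_mul_le {f g : ℝ → ℂ} (hf : Continuous f) (hg : Continuous g) {a b c : ℝ}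
    (hab : a ≤ b) (hc : 0 < c) :
    2 * ‖∫ β in a..b, f β * g β‖ ≤
      c * (∫ β in a..b, ‖f β‖ ^ 2) + 1 / c * ∫ β in a..b, ‖g β‖ ^ 2 := by
  have hF : IntervalIntegrable (fun β => c * ‖f β‖ ^ 2) MeasureTheory.volume a b :=
    Continuous.intervalIntegrable (by fun_prop) _ _
  have hG : IntervalIntegrable (fun β => 1 / c * ‖g β‖ ^ 2) MeasureTheory.volume a b :=
    Continuous.intervalIntegrable (by fun_prop) _ _
  have hFG : IntervalIntegrable (fun β => 2 * ‖f β * g β‖) MeasureTheory.volume a b :=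
    Continuous.intervalIntegrable (by fun_prop) _ _
  calc _ ≤ 2 * ∫ β in a..b, ‖f β * g β‖ := by
        gcongr
        exact intervalIntegral.norm_integral_le_integral_norm hab
    _ = ∫ β in a..b, 2 * ‖f β * g β‖ := by rw [intervalIntegral.integral_const_mul]
    _ ≤ ∫ β in a..b, (c * ‖f β‖ ^ 2 + 1 / c * ‖g β‖ ^ 2) := by
        refine intervalIntegral.integral_mono_on hab hFG (hF.add hG) fun β _ => ?_
        rw [norm_mul]
        have e : c * ‖f β‖ ^ 2 + 1 / c * ‖g β‖ ^ 2 - 2 * (‖f β‖ * ‖g β‖) =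
            (c * ‖f β‖ - ‖g β‖) ^ 2 / c := by
          field_simp
          ring
        have : 0 ≤ (c * ‖f β‖ - ‖g β‖) ^ 2 / c := by positivity
        linarith
    _ = _ := by
        rw [intervalIntegral.integral_add hF hG, intervalIntegral.integral_const_mul,
          intervalIntegral.integral_const_mul]

/-- There are few starting points of windows of length `L` free of sums of two squares. -/
theorem card_gap_mul_le {x : ℝ} (hx : 3 ≤ x) {L : ℕ} (hL : 1 ≤ L) (hLx : (L : ℝ) ≤ x)
    {J : Finset ℕ} (hJ : ∀ j ∈ J, 1 ≤ j ∧ (j : ℝ) ≤ x)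
    (hgap : ∀ j ∈ J, ∀ h < L, ∀ v, latticeNorm v ≠ (j + h : ℕ)) :
    (J.card : ℝ) * L ≤ 6 * 10 ^ 11 / (Real.pi * Real.exp (-(2 * Real.pi))) ^ 2 *
      (x * Real.log x) := by
  have hx0 : 0 < x := by linarith
  have hα : 0 < 1 / x := by positivity
  have hL0 : (0 : ℝ) < L := by exact_mod_cast hL
  -- Since j + h ≤ 2x and α = 1/x, each surviving coefficient is at least κ.
  set κ := Real.pi * Real.exp (-(2 * Real.pi)) with hκ
  have hκ0 : 0 < κ := by positivity
  have hI := integral_thetaError_mul_expSum hα (J := J) (K := Finset.range L)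
    (fun j hj => (hJ j hj).1) (fun j hj h hh => hgap j hj h (Finset.mem_range.1 hh))
  set S : ℝ := ∑ j ∈ J, ∑ h ∈ Finset.range L,
    Real.pi * Real.exp (-(Real.pi * (1 / x) * (j + h))) with hS
  have hSle : κ * L * J.card ≤ S := by
    have : κ * L * J.card = ∑ j ∈ J, ∑ h ∈ Finset.range L, κ := by
      simp
      ring
    rw [this, hS]
    refine Finset.sum_le_sum fun j hj => Finset.sum_le_sum fun h hh => ?_
    rw [hκ]
    apply mul_le_mul_of_nonneg_left _ Real.pi_pos.le
    apply Real.exp_le_exp.2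
    have h1 : (j : ℝ) + h ≤ 2 * x := by
      have : (h : ℝ) ≤ L := by exact_mod_cast (Finset.mem_range.1 hh).le
      linarith [(hJ j hj).2]
    have h2 : Real.pi * (1 / x) * (j + h) ≤ Real.pi * (1 / x) * (2 * x) := by gcongr
    have h3 : Real.pi * (1 / x) * (2 * x) = 2 * Real.pi := by field_simp
    linarith
  have hV := integral_thetaError_expSum_le hx hL hLx
  have hT := integral_norm_sq_expSum_le J
  -- The weight c = 2/(κL) makes the term with ∫|D_J|² at most κL|J|, half of the lower bound
  -- 2κL|J|, so it can be absorbed on the left.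
  have hCS := norm_integral_mul_le
    ((continuous_thetaError hα).mul (continuous_expSum (Finset.range L))) (continuous_expSum J)
    (by norm_num : (-(1 / 2) : ℝ) ≤ 1 / 2) (c := 2 / (κ * L)) (by positivity)
  have e : ∀ β, thetaError (1 / x) β * expSum (Finset.range L) β * expSum J β =
      thetaError (1 / x) β * (expSum J β * expSum (Finset.range L) β) := fun β => by ring
  simp only [Pi.mul_apply] at hCS
  simp_rw [e] at hCS
  rw [hI, Complex.norm_real, Real.norm_eq_abs] at hCS
  have h1 : 2 * (κ * L * J.card) ≤ 2 / (κ * L) * (3 * 10 ^ 11 * (x * Real.log x * L)) +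
      1 / (2 / (κ * L)) * (2 * J.card) := by
    calc _ ≤ 2 * |S| := by linarith [le_abs_self S]
      _ ≤ _ := hCS
      _ ≤ _ := by gcongr
  have h2 : 2 / (κ * L) * (3 * 10 ^ 11 * (x * Real.log x * L)) =
      κ * (6 * 10 ^ 11 / κ ^ 2 * (x * Real.log x)) := by
    field_simp
    ring
  have h3 : 1 / (2 / (κ * L)) * (2 * (J.card : ℝ)) = κ * L * J.card := by
    field_simp
  rw [h2, h3] at h1
  have h4 : κ * (J.card * L) ≤ κ * (6 * 10 ^ 11 / κ ^ 2 * (x * Real.log x)) := by linarith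
  exact le_of_mul_le_mul_left h4 hκ0

/-! ### From the measure of M(H, x) to counting gaps. -/

theorem R_le_abs_sub {y : ℝ} {n : ℕ} (hn : n ∈ sumsOfTwoSquares) : R y ≤ |y - n| :=
  (R_isLeast y).2 ⟨n, hn, rfl⟩

theorem one_mem_sumsOfTwoSquares : 1 ∈ sumsOfTwoSquares := ⟨one_pos, 1, 0, by simp⟩

theorem add_one_le_of_le_R {y H : ℝ} (hy : 0 ≤ y) (hH : 1 < H) (h : H ≤ R y) : H + 1 ≤ y := by
  have h1 := h.trans (R_le_abs_sub one_mem_sumsOfTwoSquares)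
  rw [Nat.cast_one] at h1
  rcases le_abs.1 h1 with h2 | h2 <;> linarith

/-- Each integer ⌊y⌋ + i with i < ⌊H⌋ is at distance less than H from y, so a large distance makes
⌊y⌋ the start of an empty window of length ⌊H⌋. -/
theorem latticeNorm_ne_of_le_R {y H : ℝ} (hy : 1 ≤ y) (hH : 1 < H) (h : H ≤ R y)
    {i : ℕ} (hi : i < ⌊H⌋₊) (v : ℤ × ℤ) : latticeNorm v ≠ (⌊y⌋₊ + i : ℕ) := by
  intro hv
  have hpos : 1 ≤ ⌊y⌋₊ := Nat.le_floor (by exact_mod_cast hy)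
  have h1 : ⌊y⌋₊ + i ∈ sumsOfTwoSquares := ⟨by omega, v.1, v.2, hv.symm⟩
  have h2 := h.trans (R_le_abs_sub h1)
  have h3 : ((i + 1 : ℕ) : ℝ) ≤ H := (Nat.cast_le.2 hi).trans (Nat.floor_le (by linarith))
  have h4 := Nat.floor_le (by linarith : 0 ≤ y)
  have h5 := Nat.lt_floor_add_one y
  push_cast at h2 h3
  have hi0 : (0 : ℝ) ≤ i := i.cast_nonneg
  rcases le_abs.1 h2 with h6 | h6 <;> linarith

theorem volume_le_card {M : Set ℝ} {J : Finset ℕ} (h0 : ∀ y ∈ M, 0 ≤ y)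
    (h : ∀ y ∈ M, ⌊y⌋₊ ∈ J) : MeasureTheory.volume M ≤ J.card := by
  have hsub : M ⊆ ⋃ j ∈ J, Set.Ico (j : ℝ) (j + 1) := fun y hy =>
    Set.mem_biUnion (h y hy) ⟨Nat.floor_le (h0 y hy), Nat.lt_floor_add_one y⟩
  calc _ ≤ _ := MeasureTheory.measure_mono hsub
    _ ≤ _ := MeasureTheory.measure_biUnion_finset_le _ _
    _ = _ := by simp [Real.volume_Ico]

open Classical in
theorem volume_le_of_floor_le {x H : ℝ} (hx : 3 < x) (hH : 3 < H) (hHx : H ≤ x) :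
    MeasureTheory.volume {y : ℝ | 0 ≤ y ∧ y ≤ x ∧ H ≤ R y} ≤ ENNReal.ofReal
      (12 * 10 ^ 11 / (Real.pi * Real.exp (-(2 * Real.pi))) ^ 2 * (x * Real.log x / H)) := by
  set L := ⌊H⌋₊ with hLdef
  have hLH : (L : ℝ) ≤ H := Nat.floor_le (by linarith)
  have hHL : H < L + 1 := Nat.lt_floor_add_one H
  have hL : 1 ≤ L := Nat.le_floor (by norm_num; linarith)
  have hL0 : (0 : ℝ) < L := by exact_mod_cast hL
  set J : Finset ℕ := (Finset.range (⌊x⌋₊ + 1)).filter fun j =>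
    1 ≤ j ∧ ∀ h < L, ∀ v, latticeNorm v ≠ (j + h : ℕ) with hJdef
  have hM : MeasureTheory.volume {y : ℝ | 0 ≤ y ∧ y ≤ x ∧ H ≤ R y} ≤ J.card := by
    refine volume_le_card (fun y hy => hy.1) fun y hy => ?_
    obtain ⟨hy0, hyx, hyR⟩ := hy
    have hy1 := add_one_le_of_le_R hy0 (by linarith) hyR
    rw [hJdef, Finset.mem_filter, Finset.mem_range]
    refine ⟨Nat.lt_succ_of_le (Nat.floor_le_floor hyx),
      Nat.le_floor (by norm_num; linarith), fun h hh v => ?_⟩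
    exact latticeNorm_ne_of_le_R (by linarith) (by linarith) hyR hh v
  have hcard := card_gap_mul_le (J := J) hx.le hL (hLH.trans hHx)
    (fun j hj => by
      rw [hJdef, Finset.mem_filter, Finset.mem_range] at hj
      exact ⟨hj.2.1, (Nat.cast_le.2 (Nat.lt_succ_iff.1 hj.1)).trans (Nat.floor_le (by linarith))⟩)
    (fun j hj => by
      rw [hJdef, Finset.mem_filter] at hj
      exact hj.2.2)
  refine hM.trans ?_
  rw [← ENNReal.ofReal_natCast]
  apply ENNReal.ofReal_le_ofReal
  have h1 : H ≤ 2 * L := by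
    have : (1 : ℝ) ≤ L := by exact_mod_cast hL
    linarith
  rw [← mul_div_assoc, le_div_iff₀ (by linarith)]
  calc (J.card : ℝ) * H ≤ J.card * (2 * L) := by gcongr
    _ = 2 * (J.card * L) := by ring
    _ ≤ 2 * (6 * 10 ^ 11 / (Real.pi * Real.exp (-(2 * Real.pi))) ^ 2 * (x * Real.log x)) := by
        gcongr
    _ = _ := by ring

theorem lemma10 :
    ∃ C : ℝ, 0 < C ∧ ∀ x H : ℝ, 3 < x → 3 < H →
      MeasureTheory.volume {y : ℝ | 0 ≤ y ∧ y ≤ x ∧ H ≤ R y} ≤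
        ENNReal.ofReal (C * (x * Real.log x ^ (3 / 2 : ℝ) / H)) := by
  refine ⟨12 * 10 ^ 11 / (Real.pi * Real.exp (-(2 * Real.pi))) ^ 2, by positivity,
    fun x H hx hH => ?_⟩
  rcases le_or_gt H x with hHx | hHx
  · refine (volume_le_of_floor_le hx hH hHx).trans (ENNReal.ofReal_le_ofReal ?_)
    have hlog : 1 ≤ Real.log x := by
      rw [Real.le_log_iff_exp_le (by linarith)]
      linarith [Real.exp_one_lt_d9]
    -- Here the bound x log x / H is weakened to the stated exponent.
    have h1 : Real.log x ≤ Real.log x ^ (3 / 2 : ℝ) := by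
      calc Real.log x = Real.log x ^ (1 : ℝ) := (Real.rpow_one _).symm
        _ ≤ _ := Real.rpow_le_rpow_of_exponent_le hlog (by norm_num)
    have hx0 : 0 < x := by linarith
    have hH0 : 0 < H := by linarith
    gcongr
  · have hempty : {y : ℝ | 0 ≤ y ∧ y ≤ x ∧ H ≤ R y} = ∅ := by
      ext y
      simp only [Set.mem_ofPred_eq, Set.mem_empty_iff_false, iff_false]
      rintro ⟨hy0, hyx, hyR⟩
      linarith [add_one_le_of_le_R hy0 (by linarith) hyR]
    rw [hempty, MeasureTheory.measure_empty]
    exact zero_le
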